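/- Setting. A valuation distribution $F$ is a probability distribution on $[0,\infty)$, with distribution function $F(v)=\Pr_{x\sim F}[x<v]$. We assume that $F$ has a density $f$ below the top $b\in[0,\infty]$ of its support; if $b<\infty$, an atom at $b$ is allowed (so point masses are included). For $\lambda\in[0,1]$, $F$ is $\lambda$-regular if (for a version of the density that is positive strictly inside the support) the $\lambda$-generalized virtual value $\lambda v-\frac{1-F(v)}{f(v)}$ is non-decreasing in $v$ strictly between the bottom and the top of the support. Let $\mathcal F_{(\lambda\text{-Reg})}$ be the class of $\lambda$-regular distributions. For $\lambda\in(0,1]$ and $r\in[1,(1-\lambda)^{-1/\lambda}]$ (for $\lambda=1$: $r\in[1,\infty)$), let $F_{(\lambda,r)}$ be the $r$-truncated $\lambda$-generalized Pareto distribution, $$F_{(\lambda,r)}(v)=1-\Bigl(\tfrac{r^\lambda-1}{r}\,v+1\Bigr)^{-1/\lambda}\ (0\le v\le r),\qquad F_{(\lambda,r)}(v)=1\ (v>r).$$ For $\lambda=0$ and $r\in[1,e]$, let $F_{(0,r)}(v)=1-r^{-v/r}$ for $0\le v\le r$ and $F_{(0,r)}(v)=1$ for $v>r$. Let $\mathcal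 F^*_{(\lambda)}$ be the class of all $F_{(\lambda,r)}$ with $r$ in the stated range. In a market with $m$ units and $N$ unit-demand buyers with values i.i.d. from $F$, the VCG auction gives a unit to each of the $m$ highest-value buyers, at a price equal to the $(m+1)$-th highest value ($0$ if $N\le m$); ${\sf RevVCG}_{m:N}(F)$ is its expected revenue. The Bayesian-optimal mechanism fixes a monopoly reserve $r^*\in\arg\max_{p\ge0}p\,(1-F(p))$, gives a unit to each of the $m$ highest-value buyers whose value is at least $r^*$, and charges each of them the maximum of $r^*$ and the $(m+1)$-th highest value; ${\sf RevOPT}_{m:N}(F)$ is its expected revenue. If no maximizer exists (possible only for $\lambda=1$), the monopoly reserve is $\infty$ by convention, and ${\sf RevOPT}_{m:N}(F)$ is the limit of the revenue as the reserve tends to $\infty$. For $m\le n$, $\Gamma\in(0,1]$ and a class $\mathcal F$ of distributions, the competition complexity of the VCG auction is $$\texttt{CC}(m,n,\mathcal F,\Gamma)=\min\bigl\{k\in\{0,1,2,\dots\}:\ {\sf RevVCG}_{m:n+k}(F)\ge\Gamma\cdot{\sf RevOPT}_{m:n}(F)\ \text{ for all }F\in\mathcal F\bigr\},$$ and $\infty$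 if there is no such $k$. Proposition 4.1. For all $\lambda\in[0,1]$, all $m,n\in\mathbb N$ with $m\le n$, and all $\Gamma\in(0,1]$, we have $\mathcal F^*_{(\lambda)}\subsetneq\mathcal F_{(\lambda\text{-Reg})}$ and $$\texttt{CC}\bigl(m,n,\mathcal F_{(\lambda\text{-Reg})},\Gamma\bigr)=\texttt{CC}\bigl(m,n,\mathcal F^*_{(\lambda)},\Gamma\bigr).$$ -/

import Mathlib

open MeasureTheory Set
open scoped ENNReal

noncomputable section

namespace VCGCompetition

/-! ### Valuation distributions -/

/-- A valuation distribution: a probability measure on `ℝ` concentrated on `[0, ∞)`. -/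
structure IsValuation (μ : Measure ℝ) : Prop where
  prob : IsProbabilityMeasure μ
  nonneg : μ (Iio 0) = 0

/-- The distribution function `F(v) = Pr[x < v]`
(with a strict inequality, so that `1 - F(v) = Pr[x ≥ v]` is the sale probability at price `v`). -/
def cdfLt (μ : Measure ℝ) (v : ℝ) : ℝ := μ.real (Iio v)

/-- The points strictly below the top of the support. -/
def belowTop (μ : Measure ℝ) : Set ℝ := {v | 0 < μ (Ioi v)}

/-- The points strictly between the bottom and the top of the support. -/
def insideSupport (μ : Measure ℝ) : Set ℝ := {v | 0 < μ (Iio v) ∧ 0 < μ (Ioi v)}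

/-- `f` is a probability density function of `μ` below the top of its support. An atom is possible
only at the top of the support. -/
def HasDensityBelowTop (μ : Measure ℝ) (f : ℝ → ℝ) : Prop :=
  Measurable f ∧
    μ.restrict (belowTop μ) =
      (volume.restrict (belowTop μ)).withDensity (fun v => ENNReal.ofReal (f v))

/-- The `lam`-generalized virtual value `lam * v - (1 - F(v)) / f(v)`. -/
def virtualValue (lam : ℝ) (μ : Measure ℝ) (f : ℝ → ℝ) (v : ℝ) : ℝ :=
  lam * v - (1 - cdfLt μ v) / f v

/-- The class of `lam`-regular distributions: the `lam`-generalized virtual value is non-decreasing.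
The density has to be positive inside the support: at a point with `f v = 0` the
virtual value is `-∞`, which monotonicity permits only below the support. -/
def regularClass (lam : ℝ) : Set (Measure ℝ) :=
  {μ | IsValuation μ ∧ ∃ f : ℝ → ℝ, HasDensityBelowTop μ f ∧
    (∀ v ∈ insideSupport μ, 0 < f v) ∧
    MonotoneOn (virtualValue lam μ f) (insideSupport μ)}

/-! ### Truncated generalized Pareto distributions -/

/-- The distribution function of the `r`-truncated `lam`-generalized Pareto distribution
(the truncated exponential distribution if `lam = 0`), for values `v ≥ 0`. -/
def paretoCDF (lam r v : ℝ) : ℝ :=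
  if v ≤ r then
    if lam = 0 then 1 - r ^ (-v / r)
    else 1 - ((r ^ lam - 1) / r * v + 1) ^ (-1 / lam)
  else 1

/-- The admissible truncations: `[1, e]` if `lam = 0`, `[1, (1 - lam)^(-1/lam)]` if `0 < lam < 1`,
and `[1, ∞)` if `lam = 1`. -/
def truncationRange (lam : ℝ) : Set ℝ :=
  {r | 1 ≤ r ∧ (lam = 0 → r ≤ Real.exp 1) ∧
    (0 < lam → lam < 1 → r ≤ (1 - lam) ^ (-1 / lam))}

/-- The class of truncated `lam`-generalized Pareto distributions. -/
def paretoClass (lam : ℝ) : Set (Measure ℝ) :=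
  {μ | IsValuation μ ∧ ∃ r ∈ truncationRange lam, ∀ v : ℝ, 0 ≤ v → cdfLt μ v = paretoCDF lam r v}

/-! ### Mechanisms and revenue -/

/-- The `j`-th highest entry of a value profile (`j ≥ 1`);
it is `0` if there are fewer than `j` buyers. -/
def kthHighest {N : ℕ} (v : Fin N → ℝ) (j : ℕ) : ℝ :=
  sSup {x : ℝ | j ≤ {i : Fin N | x ≤ v i}.ncard}

/-- Buyer `i` is one of the `m` highest-value buyers, ties being broken in favour of smaller
indices. -/
def IsTop {N : ℕ} (m : ℕ) (v : Fin N → ℝ) (i : Fin N) : Prop :=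
  {j : Fin N | v i < v j ∨ (v j = v i ∧ j < i)}.ncard < m

open Classical in
/-- Payments in the VCG auction: each of the `m` highest-value buyers gets a unit and pays the
`(m+1)`-th highest value. -/
def vcgPayment {N : ℕ} (m : ℕ) (v : Fin N → ℝ) (i : Fin N) : ℝ :=
  if IsTop m v i then kthHighest v (m + 1) else 0

open Classical in
/-- Payments in the mechanism with reserve `r`: each of the `m` highest-value buyers whose value is
at least `r` gets a unit and pays the maximum of `r` and the `(m+1)`-th highest value. -/
def reservePayment {N : ℕ} (m : ℕ) (r : ℝ) (v : Fin N → ℝ) (i : Fin N) : ℝ :=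
  if IsTop m v i ∧ r ≤ v i then max r (kthHighest v (m + 1)) else 0

/-- Expected sum of the payments of `N` truthful buyers with values drawn i.i.d. from `μ`. -/
def expectedRevenue {N : ℕ} (pay : (Fin N → ℝ) → Fin N → ℝ) (μ : Measure ℝ) : ℝ≥0∞ :=
  ∫⁻ v, ENNReal.ofReal (∑ i, pay v i) ∂(Measure.pi fun _ : Fin N => μ)

/-- Expected revenue of the VCG auction with `m` units and `N` buyers. -/
def revVCG (m N : ℕ) (μ : Measure ℝ) : ℝ≥0∞ :=
  expectedRevenue (N := N) (vcgPayment m) μ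

/-- A monopoly reserve: a maximizer over `p ≥ 0` of the posted-price revenue `p * (1 - F(p))`. -/
def IsMonopolyReserve (μ : Measure ℝ) (r : ℝ) : Prop :=
  0 ≤ r ∧ ∀ p : ℝ, 0 ≤ p → p * (1 - cdfLt μ p) ≤ r * (1 - cdfLt μ r)

open Classical in
/-- Expected revenue of the Bayesian-optimal mechanism with `m` units and `N` buyers: the mechanism
with a monopoly reserve. If the posted-price revenue has no maximizer (it then approaches
its supremum only as the price tends to `∞`), the monopoly reserve is `∞` by convention, and the
revenue is the limiting one for reserves tending to `∞`. -/
def revOPT (m N : ℕ) (μ : Measure ℝ) : ℝ≥0∞ :=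
  if h : ∃ r, IsMonopolyReserve μ r then
    expectedRevenue (N := N) (reservePayment m h.choose) μ
  else
    Filter.limsup (fun p : ℝ => expectedRevenue (N := N) (reservePayment m p) μ) Filter.atTop

/-- The competition complexity of the VCG auction in the `m`-unit `n`-buyer market over a class of
distributions with target approximation ratio `Γ`: the least number of additional buyers that
suffices for every distribution of the class, and `⊤` if there is none. -/
def competitionComplexity (m n : ℕ) (𝓕 : Set (Measure ℝ)) (Γ : ℝ) : ℕ∞ :=
  ⨅ (k : ℕ) (_ : ∀ μ ∈ 𝓕, ENNReal.ofReal Γ * revOPT m n μ ≤ revVCG m (n + k) μ), (k : ℕ∞)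

end VCGCompetition

end

/-! Write `S(x) = μ [x, ∞)`. The mechanism with reserve `p` earns `p` times the expected number of
units sold at price `p`, plus `m ∫_p^∞ Pr[more than m buyers are above x] dx`; VCG is the case `p =
0`. Each expectation at a price depends only on the sale probability there and is monotone in it.
Let `p` be a monopoly reserve of a regular `μ`, put `S(p) = 1/r`, and rescale values by `r/p`. The
truncated Pareto distribution with parameter `r` then has the same sale probability at its top `r`.
Its virtual value is a constant `-1/g`, whereas that of `μ` is non-decreasing, so the two hazard
rates cross at most once, that of `μ` being the smaller one first. As both survival functions are
`1` at `0` and agree at `p`, `S` dominates the rescaled Pareto survival function on `[0, p]`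
(`pareto_le_survival`). Passing from `μ` to Pareto thus keeps the posted-price term of the optimum
and can only lower the VCG revenue from prices below `p`, so the Pareto guarantee bounds the former
by the latter. The remaining terms, from prices above `p`, concern `μ` on both sides and compare
because `Γ ≤ 1` and VCG has at least as many buyers (`reserveRevenue_le_revVCG`). Domination also
makes `r` optimal for the Pareto revenue curve up to `r`, which is exactly the condition that `r` is
an admissible truncation. This argument needs `p` to be optimal only among prices up to `p`. Without
a monopoly reserve the revenue curve is non-decreasing, so every price qualifies and the bound
passes to the limit. The uniform distribution shows that the inclusion of classes is strict. -/

namespace VCGCompetition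

/-! ### Revenue as an integral of tail probabilities -/

/-- The number of buyers with value at least `x`. -/
noncomputable def buyersAbove {N : ℕ} (x : ℝ) (v : Fin N → ℝ) : ℕ :=
  (Finset.univ.filter fun i => x ≤ v i).card

lemma ncard_le_value {N : ℕ} (x : ℝ) (v : Fin N → ℝ) :
    {i : Fin N | x ≤ v i}.ncard = buyersAbove x v := by
  rw [buyersAbove, ← Set.ncard_coe_finset]
  congr 1
  ext i
  simp

lemma buyersAbove_anti {N : ℕ} (v : Fin N → ℝ) {x y : ℝ} (h : x ≤ y) :
    buyersAbove y v ≤ buyersAbove x v := by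
  apply Finset.card_le_card
  intro i hi
  simp only [Finset.mem_filter, Finset.mem_univ, true_and] at hi ⊢
  exact h.trans hi

lemma buyersAbove_le {N : ℕ} (x : ℝ) (v : Fin N → ℝ) : buyersAbove x v ≤ N :=
  (Finset.card_filter_le _ _).trans (by simp)

/-- The number of buyers ranked before buyer `i`. -/
noncomputable def rank {N : ℕ} (v : Fin N → ℝ) (i : Fin N) : ℕ :=
  (Finset.univ.filter fun j => v i < v j ∨ (v j = v i ∧ j < i)).card

lemma isTop_iff_rank_lt {N : ℕ} (m : ℕ) (v : Fin N → ℝ) (i : Fin N) :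
    IsTop m v i ↔ rank v i < m := by
  rw [IsTop, rank, ← Set.ncard_coe_finset]
  simp

lemma rank_lt_rank {N : ℕ} (v : Fin N → ℝ) {i k : Fin N}
    (h : v i < v k ∨ (v k = v i ∧ k < i)) : rank v k < rank v i := by
  apply Finset.card_lt_card
  rw [Finset.ssubset_iff_of_subset]
  · exact ⟨k, by simpa using h, by simp⟩
  · intro j hj
    simp only [Finset.mem_filter, Finset.mem_univ, true_and] at hj ⊢
    rcases h with h | ⟨h, h'⟩ <;> rcases hj with hj | ⟨hj, hj'⟩
    · exact Or.inl (h.trans hj)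
    · exact Or.inl (by rwa [hj])
    · exact Or.inl (by rwa [← h])
    · exact Or.inr ⟨hj.trans h, hj'.trans h'⟩

lemma rank_injective {N : ℕ} (v : Fin N → ℝ) : Function.Injective (rank v) := by
  intro i k hik
  by_contra hne
  rcases lt_trichotomy (v i) (v k) with h | h | h
  · exact absurd hik (rank_lt_rank v (Or.inl h)).ne'
  · rcases lt_or_gt_of_ne hne with h' | h'
    · exact absurd hik (rank_lt_rank v (Or.inr ⟨h, h'⟩)).ne
    · exact absurd hik (rank_lt_rank v (Or.inr ⟨h.symm, h'⟩)).ne'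
  · exact absurd hik (rank_lt_rank v (Or.inl h)).ne

/-- A buyer ranked before one with value at least `r` also has value at least `r`, so these buyers
form an initial segment of the ranking. Ranks are injective, and a cardinality count gives equality.
-/
lemma image_rank {N : ℕ} (r : ℝ) (v : Fin N → ℝ) :
    (Finset.univ.filter fun i => r ≤ v i).image (rank v) = Finset.range (buyersAbove r v) := by
  apply Finset.eq_of_subset_of_card_le
  · intro k hk
    obtain ⟨i, hi, rfl⟩ := Finset.mem_image.1 hk
    simp only [Finset.mem_filter, Finset.mem_univ, true_and] at hi
    rw [Finset.mem_range]
    apply Finset.card_lt_card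
    rw [Finset.ssubset_iff_of_subset]
    · exact ⟨i, by simpa using hi, by simp⟩
    · intro j hj
      simp only [Finset.mem_filter, Finset.mem_univ, true_and] at hj ⊢
      rcases hj with hj | ⟨hj, _⟩
      · exact hi.trans hj.le
      · rwa [hj]
  · rw [Finset.card_image_of_injective _ (rank_injective v), Finset.card_range, buyersAbove]

open Classical in
/-- With `m` units and reserve `r`, the number of units sold is the smaller one of `m` and the
number of buyers with value at least `r`. -/
lemma card_winners {N : ℕ} (m : ℕ) (r : ℝ) (v : Fin N → ℝ) :
    (Finset.univ.filter fun i => IsTop m v i ∧ r ≤ v i).card = min m (buyersAbove r v) := by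
  rw [← Finset.card_image_of_injective _ (rank_injective v)]
  have : (Finset.univ.filter fun i => IsTop m v i ∧ r ≤ v i).image (rank v)
      = Finset.range (min m (buyersAbove r v)) := by
    ext k
    have hk := Finset.ext_iff.1 (image_rank r v) k
    simp only [Finset.mem_image, Finset.mem_filter, Finset.mem_univ, true_and, Finset.mem_range,
      isTop_iff_rank_lt, lt_min_iff] at hk ⊢
    rw [← hk]
    constructor
    · rintro ⟨i, ⟨h1, h2⟩, rfl⟩
      exact ⟨h1, i, h2, rfl⟩
    · rintro ⟨h1, i, h2, rfl⟩
      exact ⟨i, ⟨h1, h2⟩, rfl⟩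
  rw [this, Finset.card_range]

lemma bddAbove_kthHighest {N : ℕ} (v : Fin N → ℝ) {j : ℕ} (hj : 1 ≤ j) :
    BddAbove {x : ℝ | j ≤ {i : Fin N | x ≤ v i}.ncard} := by
  refine ⟨∑ i, |v i|, fun x hx => ?_⟩
  simp only [mem_ofPred_eq, ncard_le_value] at hx
  obtain ⟨i, hi⟩ := Finset.card_pos.1 (hj.trans hx)
  simp only [Finset.mem_filter, Finset.mem_univ, true_and] at hi
  exact (hi.trans (le_abs_self _)).trans
    (Finset.single_le_sum (f := fun i => |v i|) (fun i _ => abs_nonneg _) (Finset.mem_univ i))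

lemma le_kthHighest {N : ℕ} (v : Fin N → ℝ) {j : ℕ} (hj : 1 ≤ j) {x : ℝ}
    (hx : j ≤ buyersAbove x v) : x ≤ kthHighest v j :=
  le_csSup (bddAbove_kthHighest v hj) (by simpa only [mem_ofPred_eq, ncard_le_value] using hx)

/-- The supremum defining `kthHighest` is attained because the count is left-continuous in the
price. Positivity of `x` excludes the empty set, whose supremum is `0` by convention. -/
lemma le_buyersAbove {N : ℕ} (v : Fin N → ℝ) {j : ℕ} {x : ℝ} (hx0 : 0 < x)
    (hx : x ≤ kthHighest v j) : j ≤ buyersAbove x v := by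
  have hne : {x : ℝ | j ≤ {i : Fin N | x ≤ v i}.ncard}.Nonempty := by
    by_contra h
    rw [not_nonempty_iff_eq_empty] at h
    rw [kthHighest, h, Real.sSup_empty] at hx
    linarith
  by_contra hlt
  push Not at hlt
  -- There are finitely many values, so the count is constant just below `x`.
  have hev : ∃ y < x, buyersAbove y v = buyersAbove x v := by
    have h1 : ∀ i : Fin N, ∃ y < x, ¬ x ≤ v i → ¬ y ≤ v i := by
      intro i
      by_cases h : x ≤ v i
      · exact ⟨x - 1, by linarith, fun h' => absurd h h'⟩
      · exact ⟨(x + v i) / 2, by linarith, fun _ => by push Not at h ⊢; linarith⟩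
    choose y hy hy' using h1
    rcases Nat.eq_zero_or_pos N with rfl | hN
    · exact ⟨x - 1, by linarith, by simp [buyersAbove]⟩
    · have : Nonempty (Fin N) := ⟨⟨0, hN⟩⟩
      obtain ⟨k, hk⟩ := Finite.exists_max y
      refine ⟨y k, hy k, ?_⟩
      unfold buyersAbove
      congr 1
      ext i
      simp only [Finset.mem_filter, Finset.mem_univ, true_and]
      refine ⟨fun h => ?_, fun h => (hy k).le.trans h⟩
      by_contra h'
      exact hy' i h' ((hk i).trans h)
  obtain ⟨y, hy, hyx⟩ := hev
  obtain ⟨z, hz, hyz⟩ := exists_lt_of_lt_csSup hne (hy.trans_le hx)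
  simp only [mem_ofPred_eq, ncard_le_value] at hz
  have := buyersAbove_anti v hyz.le
  omega

/-- If the `(m+1)`-th value exceeds `r`, then all `m` units are sold, so the surcharge over `r` is
paid exactly `m` times. -/
lemma sum_reservePayment {N : ℕ} (m : ℕ) {r : ℝ} (hr : 0 ≤ r) (v : Fin N → ℝ) :
    ∑ i, reservePayment m r v i =
      r * (min m (buyersAbove r v) : ℕ) + m * max (kthHighest v (m + 1) - r) 0 := by
  classical
  have h1 : ∑ i, reservePayment m r v i =
      (min m (buyersAbove r v) : ℕ) * max r (kthHighest v (m + 1)) := by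
    unfold reservePayment
    rw [← Finset.sum_filter, Finset.sum_const, nsmul_eq_mul, ← card_winners]
  rw [h1]
  rcases le_or_gt (m + 1) (buyersAbove r v) with h | h
  · have hK := le_kthHighest v (by omega) h
    rw [max_eq_right hK, max_eq_left (by linarith), min_eq_left (by omega)]
    ring
  · have hK : kthHighest v (m + 1) ≤ r := by
      by_contra hlt
      push Not at hlt
      have h2 := le_buyersAbove v (hr.trans_lt hlt) le_rfl
      have := buyersAbove_anti v hlt.le
      omega
    rw [max_eq_left hK, max_eq_right (by linarith)]
    ring

lemma measurable_buyersAbove_uncurry {N : ℕ} :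
    Measurable fun z : (Fin N → ℝ) × ℝ => buyersAbove z.2 z.1 := by
  have : (fun z : (Fin N → ℝ) × ℝ => buyersAbove z.2 z.1) =
      fun z => ∑ i : Fin N, if z.2 ≤ z.1 i then 1 else 0 := by
    funext z
    rw [buyersAbove, Finset.card_filter]
  rw [this]
  refine Finset.measurable_sum _ fun i _ => Measurable.ite ?_ measurable_const measurable_const
  exact measurableSet_le measurable_snd ((measurable_pi_apply i).comp measurable_fst)

lemma measurable_buyersAbove {N : ℕ} (x : ℝ) :
    Measurable fun v : Fin N → ℝ => buyersAbove x v :=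
  measurable_buyersAbove_uncurry.comp (measurable_id.prodMk measurable_const)

/-- The indicator function of `m < k`. -/
noncomputable def excess (m k : ℕ) : ℝ≥0∞ := if m < k then 1 else 0

lemma excess_mono (m : ℕ) : Monotone (excess m) := by
  intro a b hab
  unfold excess
  split_ifs <;> first | omega | simp

/-- The expectation of a function of the number of buyers with value at least `x`. -/
noncomputable def demandMean (N : ℕ) (φ : ℕ → ℝ≥0∞) (μ : Measure ℝ) (x : ℝ) : ℝ≥0∞ :=
  ∫⁻ v, φ (buyersAbove x v) ∂(Measure.pi fun _ : Fin N => μ)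

/-- Layer-cake formula: a price `x > r` lies below the `(m+1)`-th value iff more than `m` buyers are
above it. -/
lemma ofReal_kthHighest_sub {N : ℕ} (m : ℕ) {r : ℝ} (hr : 0 ≤ r) (v : Fin N → ℝ) :
    ENNReal.ofReal (kthHighest v (m + 1) - r) =
      ∫⁻ x in Ioi r, excess m (buyersAbove x v) := by
  have h : ∀ x ∈ Ioi r, excess m (buyersAbove x v) =
      (Iic (kthHighest v (m + 1))).indicator 1 x := by
    intro x hx
    have hx0 : 0 < x := hr.trans_lt hx
    unfold excess indicator
    have : m < buyersAbove x v ↔ x ∈ Iic (kthHighest v (m + 1)) :=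
      ⟨fun h => le_kthHighest v (by omega) h, fun h => le_buyersAbove v hx0 h⟩
    simp only [this, Pi.one_apply]
  rw [setLIntegral_congr_fun measurableSet_Ioi h, lintegral_indicator_one measurableSet_Iic,
    Measure.restrict_apply measurableSet_Iic, inter_comm, Ioi_inter_Iic, Real.volume_Ioc]

/-- The revenue with reserve `r` consists of the revenue of selling at price `r` and of the
revenue from the competition among the buyers above `r`. -/
theorem expectedRevenue_reservePayment {N : ℕ} (m : ℕ) {r : ℝ} (hr : 0 ≤ r) (μ : Measure ℝ)
    [IsProbabilityMeasure μ] :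
    expectedRevenue (N := N) (reservePayment m r) μ =
      ENNReal.ofReal r * demandMean N (fun k => (min m k : ℕ)) μ r +
        m * ∫⁻ x in Ioi r, demandMean N (excess m) μ x := by
  have h1 : ∀ v : Fin N → ℝ, ENNReal.ofReal (∑ i, reservePayment m r v i) =
      ENNReal.ofReal r * ((min m (buyersAbove r v) : ℕ) : ℝ≥0∞) +
        m * ∫⁻ x in Ioi r, excess m (buyersAbove x v) := by
    intro v
    rw [sum_reservePayment m hr, ENNReal.ofReal_add (by positivity) (by positivity),
      ENNReal.ofReal_mul hr, ENNReal.ofReal_mul (by positivity), ENNReal.ofReal_natCast,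
      ENNReal.ofReal_natCast, ← ofReal_kthHighest_sub m hr]
    congr 2
    rw [ENNReal.ofReal_max, ENNReal.ofReal_zero, max_eq_left zero_le]
  have hm : Measurable fun z : (Fin N → ℝ) × ℝ => excess m (buyersAbove z.2 z.1) :=
    (measurable_of_countable (excess m)).comp measurable_buyersAbove_uncurry
  unfold expectedRevenue demandMean
  simp_rw [h1]
  rw [lintegral_add_left, lintegral_const_mul, lintegral_const_mul, lintegral_lintegral_swap]
  · exact hm.aemeasurable
  · exact hm.lintegral_prod_right'
  · exact (measurable_of_countable fun k : ℕ => ((min m k : ℕ) : ℝ≥0∞)).comp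
      (measurable_buyersAbove r)
  · exact ((measurable_of_countable fun k : ℕ => ((min m k : ℕ) : ℝ≥0∞)).comp
      (measurable_buyersAbove r)).const_mul _

lemma vcgPayment_eq_reservePayment {N : ℕ} (m : ℕ) (v : Fin N → ℝ) (hv : ∀ i, 0 ≤ v i) :
    vcgPayment m v = reservePayment m 0 v := by
  have hK : 0 ≤ kthHighest v (m + 1) := by
    rcases le_or_gt (m + 1) (buyersAbove 0 v) with h | h
    · exact le_kthHighest v (by omega) h
    -- Here `N ≤ m`, so the set in `kthHighest` is empty and its supremum is `0`.
    · by_contra hlt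
      have hN : buyersAbove 0 v = N := by simp [buyersAbove, hv]
      refine hlt (le_of_eq ?_)
      rw [kthHighest]
      convert Real.sSup_empty.symm
      rw [eq_empty_iff_forall_notMem]
      intro x hx
      simp only [mem_ofPred_eq, ncard_le_value] at hx
      have := buyersAbove_le x v
      omega
  funext i
  unfold vcgPayment reservePayment
  rw [max_eq_right hK]
  by_cases h : IsTop m v i
  · rw [if_pos h, if_pos ⟨h, hv i⟩]
  · rw [if_neg h, if_neg fun h' => h h'.1]

lemma ae_pi_of_ae (N : ℕ) {μ : Measure ℝ} [IsProbabilityMeasure μ] {P : ℝ → Prop}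
    (h : ∀ᵐ x ∂μ, P x) : ∀ᵐ v ∂(Measure.pi fun _ : Fin N => μ), ∀ i, P (v i) :=
  ae_all_iff.2 fun i =>
    (measurePreserving_eval (fun _ : Fin N => μ) i).quasiMeasurePreserving.ae h

/-- The revenue of the VCG auction as an integral of tail probabilities. -/
theorem revVCG_eq (m N : ℕ) {μ : Measure ℝ} (hμ : IsValuation μ) :
    revVCG m N μ = m * ∫⁻ x in Ioi 0, demandMean N (excess m) μ x := by
  have := hμ.prob
  have hae : ∀ᵐ v ∂(Measure.pi fun _ : Fin N => μ), ∀ i, 0 ≤ v i := by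
    refine ae_pi_of_ae N ?_
    rw [ae_iff]
    convert hμ.nonneg using 2
    ext x
    simp
  have h : revVCG m N μ = expectedRevenue (N := N) (reservePayment m 0) μ := by
    unfold revVCG expectedRevenue
    refine lintegral_congr_ae ?_
    filter_upwards [hae] with v hv
    rw [vcgPayment_eq_reservePayment m v hv]
  rw [h, expectedRevenue_reservePayment m le_rfl]
  simp

/-! ### The demand at a price depends on the sale probability only -/

/-- Only the decision to buy at price `x` matters, and these decisions are i.i.d. Bernoulli
variables. -/
lemma demandMean_eq_lintegral_bool {N : ℕ} {μ : Measure ℝ} [IsProbabilityMeasure μ] (φ : ℕ → ℝ≥0∞) (x : ℝ) :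
    demandMean N φ μ x = ∫⁻ b, φ (Finset.univ.filter fun i => b i = true).card
      ∂(Measure.pi fun _ : Fin N => μ.map fun t => decide (x ≤ t)) := by
  have hd : Measurable fun t : ℝ => decide (x ≤ t) := by
    refine measurable_to_bool ?_
    convert measurableSet_Ici (a := x)
    ext t
    simp
  have := Measure.isProbabilityMeasure_map (μ := μ) hd.aemeasurable
  rw [← Measure.pi_map_pi (fun _ => hd.aemeasurable), lintegral_map]
  · unfold demandMean buyersAbove
    simp
  · exact measurable_of_countable _
  · exact measurable_pi_lambda _ fun i => hd.comp (measurable_pi_apply i)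

theorem demandMean_congr (N : ℕ) (φ : ℕ → ℝ≥0∞) {μ ν : Measure ℝ} [IsProbabilityMeasure μ]
    [IsProbabilityMeasure ν] {x y : ℝ} (h : μ.real (Ici x) = ν.real (Ici y)) :
    demandMean N φ μ x = demandMean N φ ν y := by
  have hd : ∀ x : ℝ, Measurable fun t : ℝ => decide (x ≤ t) := by
    intro x
    refine measurable_to_bool ?_
    convert measurableSet_Ici (a := x)
    ext t
    simp
  have h1 : ∀ x : ℝ, (fun t : ℝ => decide (x ≤ t)) ⁻¹' {true} = Ici x := by
    intro x
    ext t
    simp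
  have h2 : ∀ x : ℝ, (fun t : ℝ => decide (x ≤ t)) ⁻¹' {false} = (Ici x)ᶜ := by
    intro x
    ext t
    simp
  have h' : μ (Ici x) = ν (Ici y) := (measureReal_eq_measureReal_iff).1 h
  have hmap : μ.map (fun t => decide (x ≤ t)) = ν.map (fun t => decide (y ≤ t)) := by
    refine Measure.ext_of_singleton fun b => ?_
    rw [Measure.map_apply (hd x) (measurableSet_singleton b),
      Measure.map_apply (hd y) (measurableSet_singleton b)]
    cases b
    · rw [h2, h2, prob_compl_eq_one_sub measurableSet_Ici,
        prob_compl_eq_one_sub measurableSet_Ici, h']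
    · rw [h1, h1, h']
  rw [demandMean_eq_lintegral_bool, demandMean_eq_lintegral_bool, hmap]

/-- The uniform distribution realizes every sale probability and serves as a common model for
coupling two distributions. -/
lemma unitInterval_Ici {s : ℝ} (h0 : 0 ≤ s) (h1 : s ≤ 1) :
    (volume.restrict (Icc (0 : ℝ) 1)).real (Ici (1 - s)) = s := by
  rw [measureReal_restrict_apply measurableSet_Ici]
  have : Ici (1 - s) ∩ Icc 0 1 = Icc (1 - s) 1 := by
    ext t
    simp only [mem_inter_iff, mem_Ici, mem_Icc]
    constructor
    · rintro ⟨a, b, c⟩; exact ⟨a, c⟩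
    · rintro ⟨a, b⟩; exact ⟨a, by linarith, b⟩
  rw [this, Real.volume_real_Icc_of_le (by linarith)]
  ring

instance isProbabilityMeasure_unitInterval :
    IsProbabilityMeasure (volume.restrict (Icc (0 : ℝ) 1)) := ⟨by simp⟩

/-- Quantile coupling: both sides are moved to the uniform distribution, where the claim holds
pointwise as a comparison of two prices. -/
theorem demandMean_mono (N : ℕ) {φ : ℕ → ℝ≥0∞} (hφ : Monotone φ) {μ ν : Measure ℝ}
    [IsProbabilityMeasure μ] [IsProbabilityMeasure ν] {x y : ℝ}
    (h : μ.real (Ici x) ≤ ν.real (Ici y)) :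
    demandMean N φ μ x ≤ demandMean N φ ν y := by
  rw [demandMean_congr N φ (unitInterval_Ici measureReal_nonneg
      (measureReal_le_one (μ := μ) (s := Ici x))).symm,
    demandMean_congr N φ (unitInterval_Ici measureReal_nonneg
      (measureReal_le_one (μ := ν) (s := Ici y))).symm]
  exact lintegral_mono fun v => hφ (buyersAbove_anti v (by linarith))

/-- The first `n` of `N` i.i.d. buyers are again `n` i.i.d. buyers, and dropping the others cannot
raise the count. -/
theorem demandMean_mono_right {n N : ℕ} (hn : n ≤ N) {φ : ℕ → ℝ≥0∞} (hφ : Monotone φ)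
    (μ : Measure ℝ) [IsProbabilityMeasure μ] (x : ℝ) :
    demandMean n φ μ x ≤ demandMean N φ μ x := by
  have hmap : (Measure.pi fun _ : Fin N => μ).map (fun v i => v (Fin.castLE hn i)) =
      Measure.pi fun _ : Fin n => μ := by
    have h1 := ProbabilityTheory.iIndepFun_pi (μ := fun _ : Fin N => μ)
      (X := fun _ (t : ℝ) => t) (fun _ => aemeasurable_id)
    have h2 := h1.precomp (Fin.castLE_injective hn)
    rw [ProbabilityTheory.iIndepFun_iff_map_fun_eq_pi_map
      (fun i => (measurable_pi_apply _).aemeasurable)] at h2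
    rw [h2]
    congr 1
    funext i
    exact (measurePreserving_eval (fun _ : Fin N => μ) (Fin.castLE hn i)).map_eq
  unfold demandMean
  rw [← hmap, lintegral_map (f := fun v => φ (buyersAbove x v))
    ((measurable_of_countable φ).comp (measurable_buyersAbove x))
    (measurable_pi_lambda _ fun i => measurable_pi_apply _)]
  refine lintegral_mono fun v => hφ ?_
  unfold buyersAbove
  refine Finset.card_le_card_of_injOn (Fin.castLE hn) ?_ (Fin.castLE_injective hn).injOn
  intro i hi
  simpa using hi

lemma demandMean_eq_of_null (N : ℕ) (φ : ℕ → ℝ≥0∞) {μ : Measure ℝ} [IsProbabilityMeasure μ]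
    {x : ℝ} (h : μ.real (Ici x) = 0) : demandMean N φ μ x = φ 0 := by
  have hae : ∀ᵐ t ∂μ, ¬ x ≤ t := by
    rw [ae_iff]
    simp only [not_not]
    exact (measureReal_eq_zero_iff).1 h
  have h1 : demandMean N φ μ x = ∫⁻ _, φ 0 ∂(Measure.pi fun _ : Fin N => μ) := by
    refine lintegral_congr_ae ?_
    filter_upwards [ae_pi_of_ae N hae] with v hv
    simp [buyersAbove, hv]
  rw [h1, lintegral_const, measure_univ, mul_one]

/-! ### Comparison of survival functions through their hazard rates -/

lemma one_sub_cdfLt (μ : Measure ℝ) [IsProbabilityMeasure μ] (x : ℝ) :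
    1 - cdfLt μ x = μ.real (Ici x) := by
  rw [cdfLt, ← compl_Ici, probReal_compl_eq_one_sub measurableSet_Ici]
  ring

lemma real_Ici_anti (μ : Measure ℝ) [IsProbabilityMeasure μ] {x y : ℝ} (h : x ≤ y) :
    μ.real (Ici y) ≤ μ.real (Ici x) :=
  measureReal_mono (Ici_subset_Ici.2 h)

lemma real_Ici_eq_one {μ : Measure ℝ} [IsProbabilityMeasure μ] {x : ℝ} (h : μ (Iio x) = 0) :
    μ.real (Ici x) = 1 := by
  rw [← one_sub_cdfLt, cdfLt, measureReal_def, h]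
  simp

/-- Sale probabilities are left-continuous in the price. -/
lemma continuousWithinAt_real_Ici (μ : Measure ℝ) [IsProbabilityMeasure μ] (x : ℝ) :
    ContinuousWithinAt (fun z => μ.real (Ici z)) (Iic x) x := by
  have hp : IsProbabilityMeasure (μ.map fun z => -z) :=
    Measure.isProbabilityMeasure_map measurable_neg.aemeasurable
  have h1 : (fun z => μ.real (Ici z)) =
      fun z => ProbabilityTheory.cdf (μ.map fun z => -z) (-z) := by
    funext z
    rw [ProbabilityTheory.cdf_eq_real, map_measureReal_apply measurable_neg measurableSet_Iic]
    congr 1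
    ext t
    simp
  rw [h1]
  refine ContinuousWithinAt.comp (t := Ici (-x))
    ((ProbabilityTheory.cdf (μ.map fun z => -z)).right_continuous (-x))
    continuous_neg.continuousWithinAt ?_
  intro z hz
  simpa using hz

/-- As `[p, ∞)` has positive mass, every point before `p` is below the top. The half-open interval
leaves out a possible atom at `p`. -/
lemma measure_Ico_eq_lintegral {μ : Measure ℝ} {f : ℝ → ℝ} (hf : HasDensityBelowTop μ f)
    {p s t : ℝ} (hp : 0 < μ (Ici p)) (ht : t ≤ p) :
    μ (Ico s t) = ∫⁻ x in Ico s t, ENNReal.ofReal (f x) := by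
  have hsub : Ico s t ⊆ belowTop μ := fun z hz =>
    hp.trans_le (measure_mono (Ici_subset_Ioi.2 (hz.2.trans_le ht)))
  have h1 := congrArg (fun ν : Measure ℝ => ν (Ico s t)) hf.2
  rwa [Measure.restrict_apply measurableSet_Ico, withDensity_apply _ measurableSet_Ico,
    Measure.restrict_restrict measurableSet_Ico, inter_eq_left.2 hsub] at h1

lemma lintegral_neg_deriv {T g : ℝ → ℝ} {s t : ℝ} (hst : s ≤ t)
    (hT : ∀ z ∈ Icc s t, HasDerivAt T (-g z) z) (hg : ContinuousOn g (Icc s t))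
    (hg0 : ∀ z ∈ Icc s t, 0 ≤ g z) :
    ∫⁻ z in Ico s t, ENNReal.ofReal (g z) = ENNReal.ofReal (T s - T t) := by
  have hi : IntervalIntegrable g volume s t := by
    apply ContinuousOn.intervalIntegrable
    rwa [uIcc_of_le hst]
  have h1 : ∫ z in s..t, -g z = T t - T s := by
    refine intervalIntegral.integral_eq_sub_of_hasDerivAt (fun z hz => ?_) hi.neg
    rw [uIcc_of_le hst] at hz
    exact hT z hz
  rw [intervalIntegral.integral_neg, intervalIntegral.integral_of_le hst] at h1
  have h2 : T s - T t = ∫ z in Ioc s t, g z := by linarith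
  rw [h2, ofReal_integral_eq_lintegral_ofReal, Measure.restrict_congr_set Ico_ae_eq_Ioc]
  · exact (intervalIntegrable_iff_integrableOn_Ioc_of_le hst).1 hi
  · refine (ae_restrict_iff' measurableSet_Ioc).2 (ae_of_all _ fun z hz => ?_)
    exact hg0 z (Ioc_subset_Icc_self hz)

lemma real_Ici_sub {μ : Measure ℝ} [IsProbabilityMeasure μ] {s t : ℝ} (hst : s ≤ t) :
    μ.real (Ici s) - μ.real (Ici t) = μ.real (Ico s t) := by
  rw [← Ico_union_Ici_eq_Ici hst, measureReal_union _ measurableSet_Ici]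
  · ring
  · rw [Set.disjoint_left]
    intro z hz hz'
    exact absurd hz.2 (not_lt.2 hz')

/-- A left-continuous function that starts non-positive and does not increase while it is
positive stays non-positive. -/
lemma nonpos_of_nonincreasing_where_pos {D : ℝ → ℝ} {x y : ℝ} (hxy : x ≤ y)
    (hD : ∀ z ∈ Icc x y, ContinuousWithinAt D (Iic z) z) (hx : D x ≤ 0)
    (h : ∀ s t, x ≤ s → s ≤ t → t ≤ y → (∀ z ∈ Ioc s t, 0 < D z) → D t ≤ D s) : D y ≤ 0 := by
  -- The supremum of `E` lies in `E` by left-continuity, and `D` is positive from there on to `y`.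
  set E := {z | z ∈ Icc x y ∧ D z ≤ 0} with hE
  have hxE : x ∈ E := ⟨left_mem_Icc.2 hxy, hx⟩
  have hbd : BddAbove E := ⟨y, fun z hz => hz.1.2⟩
  set s := sSup E
  have hxs : x ≤ s := le_csSup hbd hxE
  have hsy : s ≤ y := csSup_le ⟨x, hxE⟩ fun z hz => hz.1.2
  have hDs : D s ≤ 0 := by
    have h1 : ContinuousWithinAt D E s :=
      (hD s ⟨hxs, hsy⟩).mono fun z hz => le_csSup hbd hz
    have h2 := h1.mem_closure_image (csSup_mem_closure ⟨x, hxE⟩ hbd)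
    have h3 : closure (D '' E) ⊆ Iic 0 := by
      refine closure_minimal ?_ isClosed_Iic
      rintro _ ⟨z, hz, rfl⟩
      exact hz.2
    exact h3 h2
  refine (h s y hxs hsy le_rfl fun z hz => ?_).trans hDs
  by_contra hz0
  push Not at hz0
  exact absurd (le_csSup hbd (show z ∈ E from ⟨⟨hxs.trans hz.1.le, hz.2⟩, hz0⟩)) (not_le.2 hz.1)

/-- If the hazard rate of `μ` is at most `k` on an interval, then the survival function of `μ`
stays above a survival function with hazard rate `k` that it starts above. -/
lemma le_survival_of_hazard_le {μ : Measure ℝ} [IsProbabilityMeasure μ] {f T k : ℝ → ℝ}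
    (hf : HasDensityBelowTop μ f) {p x y : ℝ} (hp : 0 < μ (Ici p)) (hxy : x ≤ y) (hyp : y ≤ p)
    (hT : ∀ z ∈ Icc x y, HasDerivAt T (-(T z * k z)) z) (hk : ContinuousOn k (Icc x y))
    (hk0 : ∀ z ∈ Icc x y, 0 ≤ k z) (hT0 : ∀ z ∈ Icc x y, 0 ≤ T z)
    (hT1 : ∀ z ∈ Icc x y, T z ≤ 1) (hx : T x ≤ μ.real (Ici x))
    (hfk : ∀ z ∈ Ioo x y, 0 < μ (Iio z) → f z ≤ μ.real (Ici z) * k z) :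
    T y ≤ μ.real (Ici y) := by
  have hTc : ContinuousOn T (Icc x y) := fun z hz => (hT z hz).continuousAt.continuousWithinAt
  suffices h : T y - μ.real (Ici y) ≤ 0 by linarith
  refine nonpos_of_nonincreasing_where_pos (D := fun z => T z - μ.real (Ici z)) hxy
    (fun z hz => (hT z hz).continuousAt.continuousWithinAt.sub (continuousWithinAt_real_Ici μ z))
    (by simpa using hx) ?_
  intro s t hs hst ht hpos
  have hsub : Icc s t ⊆ Icc x y := Icc_subset_Icc hs ht
  -- While `T` exceeds the survival function `S` of `μ`, one has `f ≤ S k ≤ T k`, so `S` loses no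
  -- more than `T` and the gap does not grow.
  have h1 : μ (Ico s t) ≤ ENNReal.ofReal (T s - T t) := by
    rw [measure_Ico_eq_lintegral hf hp (ht.trans hyp), ← lintegral_neg_deriv hst
      (fun z hz => hT z (hsub hz)) ((hTc.mul hk).mono hsub)
      (fun z hz => mul_nonneg (hT0 z (hsub hz)) (hk0 z (hsub hz))),
      Measure.restrict_congr_set (Ioo_ae_eq_Ico).symm]
    refine setLIntegral_mono' measurableSet_Ioo fun z hz => ENNReal.ofReal_le_ofReal ?_
    have hz' := hsub (Ioo_subset_Icc_self hz)
    have hzp := hpos z (Ioo_subset_Ioc_self hz)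
    -- Below the support the survival function is `1 ≥ T z`, which contradicts the positive gap.
    have hin : 0 < μ (Iio z) := by
      by_contra h0
      have := real_Ici_eq_one (μ := μ) (x := z) (by simpa using h0)
      have := hT1 z hz'
      linarith
    refine (hfk z ⟨hs.trans_lt hz.1, hz.2.trans_le ht⟩ hin).trans ?_
    exact mul_le_mul_of_nonneg_right (by linarith) (hk0 z hz')
  have hTst : 0 ≤ T s - T t := by
    have hanti : AntitoneOn T (Icc s t) := by
      refine antitoneOn_of_deriv_nonpos (convex_Icc s t) (hTc.mono hsub) ?_ ?_
      · intro z hz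
        rw [interior_Icc] at hz
        exact (hT z (hsub (Ioo_subset_Icc_self hz))).differentiableAt.differentiableWithinAt
      · intro z hz
        rw [interior_Icc] at hz
        have hz' := hsub (Ioo_subset_Icc_self hz)
        rw [(hT z hz').deriv]
        have := mul_nonneg (hT0 z hz') (hk0 z hz')
        linarith
    have := hanti (left_mem_Icc.2 hst) (right_mem_Icc.2 hst) hst
    linarith
  have h2 : μ.real (Ico s t) ≤ T s - T t := ENNReal.toReal_le_of_le_ofReal hTst h1
  rw [← real_Ici_sub hst] at h2
  linarith

/-- If the hazard rate of `μ` is at least `k` on an interval, then the survival function of `μ`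
stays below a survival function with hazard rate `k` that it starts below. -/
lemma survival_le_of_le_hazard {μ : Measure ℝ} [IsProbabilityMeasure μ] {f T k : ℝ → ℝ}
    (hf : HasDensityBelowTop μ f) {p x y : ℝ} (hp : 0 < μ (Ici p)) (hxy : x ≤ y) (hyp : y ≤ p)
    (hT : ∀ z ∈ Icc x y, HasDerivAt T (-(T z * k z)) z) (hk : ContinuousOn k (Icc x y))
    (hk0 : ∀ z ∈ Icc x y, 0 ≤ k z) (hT0 : ∀ z ∈ Icc x y, 0 ≤ T z)
    (hx : μ.real (Ici x) ≤ T x)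
    (hfk : ∀ z ∈ Ioo x y, μ.real (Ici z) * k z ≤ f z) :
    μ.real (Ici y) ≤ T y := by
  have hTc : ContinuousOn T (Icc x y) := fun z hz => (hT z hz).continuousAt.continuousWithinAt
  suffices h : μ.real (Ici y) - T y ≤ 0 by linarith
  refine nonpos_of_nonincreasing_where_pos (D := fun z => μ.real (Ici z) - T z) hxy
    (fun z hz => (continuousWithinAt_real_Ici μ z).sub (hT z hz).continuousAt.continuousWithinAt)
    (by simpa using hx) ?_
  intro s t hs hst ht hpos
  have hsub : Icc s t ⊆ Icc x y := Icc_subset_Icc hs ht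
  have h1 : ENNReal.ofReal (T s - T t) ≤ μ (Ico s t) := by
    rw [measure_Ico_eq_lintegral hf hp (ht.trans hyp), ← lintegral_neg_deriv hst
      (fun z hz => hT z (hsub hz)) ((hTc.mul hk).mono hsub)
      (fun z hz => mul_nonneg (hT0 z (hsub hz)) (hk0 z (hsub hz))),
      Measure.restrict_congr_set (Ioo_ae_eq_Ico).symm]
    refine setLIntegral_mono' measurableSet_Ioo fun z hz => ENNReal.ofReal_le_ofReal ?_
    have hz' := hsub (Ioo_subset_Icc_self hz)
    have hzp := hpos z (Ioo_subset_Ioc_self hz)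
    refine le_trans ?_ (hfk z ⟨hs.trans_lt hz.1, hz.2.trans_le ht⟩)
    exact mul_le_mul_of_nonneg_right (by linarith) (hk0 z hz')
  have h2 : T s - T t ≤ μ.real (Ico s t) := (ENNReal.ofReal_le_iff_le_toReal (by simp)).1 h1
  rw [← real_Ici_sub hst] at h2
  linarith

lemma mem_insideSupport_of_lt {μ : Measure ℝ} {p z : ℝ} (hp : 0 < μ (Ici p)) (hz : z < p)
    (h : 0 < μ (Iio z)) : z ∈ insideSupport μ :=
  ⟨h, hp.trans_le (measure_mono (Ici_subset_Ioi.2 hz))⟩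

lemma pos_Iio_of_le {μ : Measure ℝ} {x z : ℝ} (hz : x ≤ z) (h : 0 < μ (Iio x)) :
    0 < μ (Iio z) :=
  h.trans_le (measure_mono (Iio_subset_Iio hz))

/-- The survival function of a regular distribution lies above the generalized Pareto survival
function through the points at `0` and at `p`: the hazard rates cross at most once. -/
theorem pareto_le_survival {lam : ℝ} (hlam : 0 ≤ lam) {μ : Measure ℝ} (hμ : IsValuation μ)
    {f : ℝ → ℝ} (hf : HasDensityBelowTop μ f) (hf0 : ∀ v ∈ insideSupport μ, 0 < f v)
    (hmono : MonotoneOn (virtualValue lam μ f) (insideSupport μ)) {p g : ℝ} (hg : 0 < g)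
    (hp : 0 < μ.real (Ici p)) {T : ℝ → ℝ}
    (hT : ∀ z ∈ Icc 0 p, HasDerivAt T (-(T z * (g / (lam * g * z + 1)))) z)
    (hT0 : ∀ z ∈ Icc 0 p, 0 < T z) (hT1 : ∀ z ∈ Icc 0 p, T z ≤ 1)
    (hTp : T p = μ.real (Ici p)) {v : ℝ} (hv : v ∈ Icc 0 p) : T v ≤ μ.real (Ici v) := by
  have := hμ.prob
  have hp' : 0 < μ (Ici p) := by
    rw [measureReal_def] at hp
    exact (ENNReal.toReal_pos_iff.1 hp).1
  have hden : ∀ z ∈ Icc 0 p, 0 < lam * g * z + 1 := fun z hz => by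
    have := mul_nonneg (mul_nonneg hlam hg.le) hz.1
    linarith
  have hk : ContinuousOn (fun z => g / (lam * g * z + 1)) (Icc 0 p) :=
    ContinuousOn.div (by fun_prop) (by fun_prop) fun z hz => (hden z hz).ne'
  have hk0 : ∀ z ∈ Icc 0 p, 0 ≤ g / (lam * g * z + 1) := fun z hz =>
    div_nonneg hg.le (hden z hz).le
  rcases hv.2.eq_or_lt with rfl | hvp
  · exact hTp.le
  by_cases hin : 0 < μ (Iio v)
  swap
  · rw [real_Ici_eq_one (by simpa using hin)]
    exact hT1 v hv
  have hvin := mem_insideSupport_of_lt hp' hvp hin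
  -- The constant `-1 / g` is the virtual value of a survival function with hazard rate `g / (lam *
  -- g * z + 1)`. By monotonicity, the hazard rate of `μ` is at most this rate before `v` in the
  -- first case, and at least this rate after `v` in the second.
  rcases le_total (virtualValue lam μ f v) (-1 / g) with hvv | hvv
  · have hsub : Icc 0 v ⊆ Icc 0 p := Icc_subset_Icc le_rfl hv.2
    refine le_survival_of_hazard_le hf hp' hv.1 hv.2 (fun z hz => hT z (hsub hz)) (hk.mono hsub)
      (fun z hz => hk0 z (hsub hz)) (fun z hz => (hT0 z (hsub hz)).le)
      (fun z hz => hT1 z (hsub hz)) ?_ ?_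
    · rw [real_Ici_eq_one hμ.nonneg]
      exact hT1 0 (hsub (left_mem_Icc.2 hv.1))
    · intro z hz hzin
      have hzin' := mem_insideSupport_of_lt hp' (hz.2.trans hvp) hzin
      have h1 := (hmono hzin' hvin hz.2.le).trans hvv
      rw [virtualValue, one_sub_cdfLt] at h1
      have hfz := hf0 z hzin'
      have hd := hden z ⟨hz.1.le, (hz.2.trans hvp).le⟩
      have h2 : (lam * g * z + 1) / g ≤ μ.real (Ici z) / f z := by
        have : (lam * g * z + 1) / g = lam * z - -1 / g := by field_simp; ring
        linarith
      rw [div_le_div_iff₀ hg hfz] at h2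
      rw [← mul_div_assoc, le_div_iff₀ hd]
      linarith
  · by_contra hlt
    push Not at hlt
    have hTv := hT0 v hv
    -- Scaling `T` to agree with `μ` at `v` keeps its hazard rate. The comparison from `v` to `p`
    -- then bounds the survival function at `p` by `c * T p < T p`, contrary to `hTp`.
    set c := μ.real (Ici v) / T v with hc
    have hc1 : c < 1 := (div_lt_one hTv).2 hlt
    have hc0 : 0 ≤ c := div_nonneg measureReal_nonneg hTv.le
    have hsub : Icc v p ⊆ Icc 0 p := Icc_subset_Icc hv.1 le_rfl
    have h := survival_le_of_le_hazard (T := fun z => c * T z) hf hp' hv.2 le_rfl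
      (fun z hz => by
        refine ((hT z (hsub hz)).const_mul c).congr_deriv ?_
        ring) (hk.mono hsub)
      (fun z hz => hk0 z (hsub hz)) (fun z hz => mul_nonneg hc0 (hT0 z (hsub hz)).le)
      (by rw [hc, div_mul_cancel₀ _ hTv.ne']) (by
        intro z hz
        have hzin' := mem_insideSupport_of_lt hp' hz.2 (pos_Iio_of_le hz.1.le hin)
        have h1 := hvv.trans (hmono hvin hzin' hz.1.le)
        rw [virtualValue, one_sub_cdfLt] at h1
        have hfz := hf0 z hzin'
        have hd := hden z ⟨hv.1.trans hz.1.le, hz.2.le⟩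
        have h2 : μ.real (Ici z) / f z ≤ (lam * g * z + 1) / g := by
          have : (lam * g * z + 1) / g = lam * z - -1 / g := by field_simp; ring
          linarith
        rw [div_le_div_iff₀ hfz hg] at h2
        rw [← mul_div_assoc, div_le_iff₀ hd]
        linarith)
    simp only [hTp] at h
    nlinarith

/-- If the posted-price revenue of a regular distribution decreases somewhere, then it does not
exceed its value there again. -/
theorem postedRevenue_le_of_decreasing {lam : ℝ} (hlam : lam ≤ 1) {μ : Measure ℝ}
    (hμ : IsValuation μ) {f : ℝ → ℝ} (hf : HasDensityBelowTop μ f)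
    (hf0 : ∀ v ∈ insideSupport μ, 0 < f v)
    (hmono : MonotoneOn (virtualValue lam μ f) (insideSupport μ)) {x y p : ℝ} (hx : 0 ≤ x)
    (hxy : x < y) (hyp : y < p)
    (hdec : y * μ.real (Ici y) < x * μ.real (Ici x)) :
    p * μ.real (Ici p) ≤ y * μ.real (Ici y) := by
  have := hμ.prob
  have hS : ∀ z, 0 ≤ μ.real (Ici z) := fun z => measureReal_nonneg
  have hy0 : 0 < y := hx.trans_lt hxy
  rcases (hS p).eq_or_lt with hp0 | hp
  · rw [← hp0, mul_zero]
    exact mul_nonneg hy0.le (hS y)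
  have hp' : 0 < μ (Ici p) := by
    rw [measureReal_def] at hp
    exact (ENNReal.toReal_pos_iff.1 hp).1
  have hx0 : 0 < x := by
    rcases hx.eq_or_lt with rfl | h
    · have := mul_nonneg hy0.le (hS y)
      linarith
    · exact h
  have hin : 0 < μ (Iio y) := by
    by_contra h
    rw [real_Ici_eq_one (by simpa using h)] at hdec
    have : μ.real (Ici x) ≤ 1 := measureReal_le_one
    nlinarith
  have hyin := mem_insideSupport_of_lt hp' hyp hin
  have hderiv : ∀ C z : ℝ, 0 < z → HasDerivAt (fun z => C / z) (-(C / z * (1 / z))) z := by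
    intro C z hz
    simp only [div_eq_mul_inv]
    refine ((hasDerivAt_inv hz.ne').const_mul C).congr_deriv ?_
    field_simp
  have hinv : ∀ a b : ℝ, 0 < a → ContinuousOn (fun z : ℝ => 1 / z) (Icc a b) := fun a b ha =>
    ContinuousOn.div (by fun_prop) (by fun_prop) fun z hz => (ha.trans_le hz.1).ne'
  -- Regularity for `lam ≤ 1` implies regularity for `1`, whose virtual value has the sign that
  -- governs the posted-price revenue.
  have hfac : ∀ z, virtualValue 1 μ f z = virtualValue lam μ f z + (1 - lam) * z := by
    intro z
    rw [virtualValue, virtualValue]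
    ring
  have hmono1 : MonotoneOn (virtualValue 1 μ f) (insideSupport μ) := by
    intro a ha b hb hab
    rw [hfac, hfac]
    have h1 := hmono ha hb hab
    have h2 := mul_le_mul_of_nonneg_left hab (sub_nonneg.2 hlam)
    linarith
  -- Comparison with the equal-revenue curves `C / z`, of hazard rate `1 / z`. A non-positive
  -- virtual value at `y` would prevent the decrease from `x` to `y`; a non-negative one keeps the
  -- later revenue at or below that of `y`.
  rcases le_total (virtualValue 1 μ f y) 0 with hvv | hvv
  · exfalso
    have h := le_survival_of_hazard_le (T := fun z => x * μ.real (Ici x) / z) hf hp' hxy.le hyp.le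
      (fun z hz => hderiv _ z (hx0.trans_le hz.1)) (hinv x y hx0)
      (fun z hz => by have := hx0.trans_le hz.1; positivity)
      (fun z hz => by have := hx0.trans_le hz.1; positivity)
      (fun z hz => by
        have hz0 := hx0.trans_le hz.1
        have : μ.real (Ici x) ≤ 1 := measureReal_le_one
        rw [div_le_one hz0]
        nlinarith [hz.1])
      (by rw [mul_div_cancel_left₀ _ hx0.ne']) (by
        intro z hz hzin
        have hz0 := hx0.trans hz.1
        have hzin' := mem_insideSupport_of_lt hp' (hz.2.trans hyp) hzin
        have h1 := (hmono1 hzin' hyin hz.2.le).trans hvv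
        rw [virtualValue, one_sub_cdfLt] at h1
        have hfz := hf0 z hzin'
        have h2 : z ≤ μ.real (Ici z) / f z := by linarith
        rw [le_div_iff₀ hfz] at h2
        rw [mul_one_div, le_div_iff₀ hz0]
        linarith)
    rw [div_le_iff₀ hy0] at h
    linarith
  · have h := survival_le_of_le_hazard (T := fun z => y * μ.real (Ici y) / z) hf hp' hyp.le le_rfl
      (fun z hz => hderiv _ z (hy0.trans_le hz.1)) (hinv y p hy0)
      (fun z hz => by have := hy0.trans_le hz.1; positivity)
      (fun z hz => by have := hy0.trans_le hz.1; positivity)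
      (by rw [mul_div_cancel_left₀ _ hy0.ne']) (by
        intro z hz
        have hz0 := hy0.trans hz.1
        have hzin' := mem_insideSupport_of_lt hp' hz.2 (pos_Iio_of_le hz.1.le hin)
        have h1 := hvv.trans (hmono1 hyin hzin' hz.1.le)
        rw [virtualValue, one_sub_cdfLt] at h1
        have hfz := hf0 z hzin'
        have h2 : μ.real (Ici z) / f z ≤ z := by linarith
        rw [div_le_iff₀ hfz] at h2
        rw [mul_one_div, div_le_iff₀ hz0]
        linarith)
    rw [le_div_iff₀ (hy0.trans hyp)] at h
    linarith

/-- From the left the revenue is continuous; to the right sale probabilities can only drop. This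
suffices for a maximum on a compact interval. -/
lemma upperSemicontinuousOn_postedRevenue (μ : Measure ℝ) [IsProbabilityMeasure μ] (b : ℝ) :
    UpperSemicontinuousOn (fun z => z * μ.real (Ici z)) (Icc 0 b) := by
  intro x hx c hc
  have h1 : ∀ᶠ z in nhdsWithin x (Iic x), z * μ.real (Ici z) < c :=
    (continuousWithinAt_id.mul (continuousWithinAt_real_Ici μ x)).eventually_lt_const hc
  have h2 : ∀ᶠ z in nhdsWithin x (Ici x), z * μ.real (Ici z) < c := by
    have h3 : ContinuousWithinAt (fun z => z * μ.real (Ici x)) (Ici x) x := by fun_prop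
    filter_upwards [h3.eventually_lt_const hc, self_mem_nhdsWithin] with z hz hxz
    refine lt_of_le_of_lt ?_ hz
    exact mul_le_mul_of_nonneg_left (real_Ici_anti μ hxz) (hx.1.trans hxz)
  have h4 : ∀ᶠ z in nhds x, z * μ.real (Ici z) < c := by
    rw [← nhdsWithin_univ, ← Iic_union_Ici (a := x), nhdsWithin_union]
    exact Filter.eventually_sup.2 ⟨h1, h2⟩
  exact nhdsWithin_le_nhds h4

/-- Without a monopoly reserve, the posted-price revenue of a regular distribution is
non-decreasing in the price. -/
theorem postedRevenue_mono_of_not_exists {lam : ℝ} (hlam : lam ≤ 1) {μ : Measure ℝ}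
    (hμ : μ ∈ regularClass lam) (hno : ¬ ∃ r, IsMonopolyReserve μ r) {x y : ℝ} (hx : 0 ≤ x)
    (hxy : x ≤ y) : x * μ.real (Ici x) ≤ y * μ.real (Ici y) := by
  obtain ⟨hval, f, hf, hf0, hmono⟩ := hμ
  have := hval.prob
  by_contra hlt
  push Not at hlt
  have hxy' : x < y := hxy.lt_of_ne (by rintro rfl; exact lt_irrefl _ hlt)
  -- Since the revenue never again exceeds its value at `y`, a maximizer over `[0, y]` is a monopoly
  -- reserve.
  obtain ⟨r, hr, hmax⟩ := (upperSemicontinuousOn_postedRevenue μ y).exists_isMaxOn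
    (nonempty_Icc.2 (hx.trans hxy)) isCompact_Icc
  refine hno ⟨r, hr.1, fun p hp => ?_⟩
  rw [one_sub_cdfLt, one_sub_cdfLt]
  rcases le_or_gt p y with hpy | hpy
  · exact hmax ⟨hp, hpy⟩
  · exact (postedRevenue_le_of_decreasing hlam hval hf hf0 hmono hx hxy' hpy hlt).trans
      (hmax (right_mem_Icc.2 (hx.trans hxy)))

/-! ### Truncated generalized Pareto distributions -/

/-- The survival function of the `lam`-generalized Pareto distribution before truncation. -/
noncomputable def paretoSurvival (lam r v : ℝ) : ℝ :=
  if lam = 0 then r ^ (-v / r) else ((r ^ lam - 1) / r * v + 1) ^ (-1 / lam)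

/-- The hazard rate of the `lam`-generalized Pareto distribution at `0`. -/
noncomputable def paretoRate (lam r : ℝ) : ℝ :=
  if lam = 0 then Real.log r / r else (r ^ lam - 1) / (lam * r)

lemma paretoCDF_of_le {lam r v : ℝ} (h : v ≤ r) :
    paretoCDF lam r v = 1 - paretoSurvival lam r v := by
  unfold paretoCDF paretoSurvival
  rw [if_pos h]
  split_ifs <;> rfl

lemma paretoCDF_of_lt {lam r v : ℝ} (h : r < v) : paretoCDF lam r v = 1 := by
  rw [paretoCDF, if_neg (not_le.2 h)]

section

variable {lam r : ℝ}

lemma paretoRate_nonneg (hlam : 0 ≤ lam) (hr : 1 ≤ r) : 0 ≤ paretoRate lam r := by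
  unfold paretoRate
  have hr0 : 0 ≤ r := by linarith
  split_ifs with h
  · exact div_nonneg (Real.log_nonneg hr) hr0
  · exact div_nonneg (by linarith [Real.one_le_rpow hr hlam]) (mul_nonneg hlam hr0)

lemma paretoRate_pos (hlam : 0 ≤ lam) (hr : 1 < r) : 0 < paretoRate lam r := by
  unfold paretoRate
  have hr0 : 0 < r := by linarith
  split_ifs with h
  · exact div_pos (Real.log_pos hr) hr0
  · have hl : 0 < lam := lt_of_le_of_ne hlam (Ne.symm h)
    exact div_pos (by linarith [Real.one_lt_rpow hr hl]) (mul_pos hl hr0)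

lemma paretoSurvival_zero : paretoSurvival lam r 0 = 1 := by
  unfold paretoSurvival
  split_ifs <;> simp

lemma paretoSurvival_self (hr : 1 ≤ r) : paretoSurvival lam r r = r⁻¹ := by
  have hr0 : 0 < r := by linarith
  unfold paretoSurvival
  split_ifs with h
  · rw [neg_div, div_self hr0.ne', Real.rpow_neg_one]
  · rw [div_mul_cancel₀ _ hr0.ne', sub_add_cancel, ← Real.rpow_mul hr0.le, mul_div_cancel₀ _ h,
      Real.rpow_neg_one]

lemma one_le_paretoBase (hlam : 0 ≤ lam) (hr : 1 ≤ r) {v : ℝ} (hv : 0 ≤ v) :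
    1 ≤ (r ^ lam - 1) / r * v + 1 := by
  have h1 : 0 ≤ (r ^ lam - 1) / r :=
    div_nonneg (by linarith [Real.one_le_rpow hr hlam]) (by linarith)
  have := mul_nonneg h1 hv
  linarith

lemma paretoSurvival_pos (hlam : 0 ≤ lam) (hr : 1 ≤ r) {v : ℝ} (hv : 0 ≤ v) :
    0 < paretoSurvival lam r v := by
  unfold paretoSurvival
  split_ifs with h
  · exact Real.rpow_pos_of_pos (by linarith) _
  · exact Real.rpow_pos_of_pos (by linarith [one_le_paretoBase hlam hr hv]) _

lemma paretoSurvival_le_one (hlam : 0 ≤ lam) (hr : 1 ≤ r) {v : ℝ} (hv : 0 ≤ v) :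
    paretoSurvival lam r v ≤ 1 := by
  unfold paretoSurvival
  split_ifs with h
  · exact Real.rpow_le_one_of_one_le_of_nonpos hr
      (div_nonpos_of_nonpos_of_nonneg (by linarith) (by linarith))
  · exact Real.rpow_le_one_of_one_le_of_nonpos (one_le_paretoBase hlam hr hv)
      (div_nonpos_of_nonpos_of_nonneg (by linarith) hlam)

lemma paretoDenom_pos (hlam : 0 ≤ lam) (hr : 1 ≤ r) {v : ℝ} (hv : 0 ≤ v) :
    0 < lam * paretoRate lam r * v + 1 := by
  have := mul_nonneg (mul_nonneg hlam (paretoRate_nonneg hlam hr)) hv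
  linarith

/-- The hazard rate of the generalized Pareto distribution. -/
lemma hasDerivAt_paretoSurvival (hlam : 0 ≤ lam) (hr : 1 ≤ r) {v : ℝ} (hv : 0 ≤ v) :
    HasDerivAt (paretoSurvival lam r)
      (-(paretoSurvival lam r v * (paretoRate lam r / (lam * paretoRate lam r * v + 1)))) v := by
  have hr0 : 0 < r := by linarith
  by_cases h : lam = 0
  · have h1 : paretoSurvival lam r = fun v => r ^ (-v / r) := by
      funext v
      rw [paretoSurvival, if_pos h]
    rw [h1, paretoRate, if_pos h, h]
    have h2 : HasDerivAt (fun v : ℝ => -v / r) (-1 / r) v := (hasDerivAt_id v).neg.div_const r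
    refine (h2.const_rpow hr0).congr_deriv ?_
    rw [zero_mul, zero_mul, zero_add, div_one]
    ring
  · have h1 : paretoSurvival lam r = fun v => ((r ^ lam - 1) / r * v + 1) ^ (-1 / lam) := by
      funext v
      rw [paretoSurvival, if_neg h]
    have hbase := one_le_paretoBase hlam hr hv
    rw [h1, paretoRate, if_neg h]
    have h2 : HasDerivAt (fun v : ℝ => (r ^ lam - 1) / r * v + 1) ((r ^ lam - 1) / r * 1) v :=
      ((hasDerivAt_id v).const_mul _).add_const 1
    refine (h2.rpow_const (p := -1 / lam) (Or.inl (by linarith))).congr_deriv ?_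
    rw [Real.rpow_sub_one (by linarith)]
    have h3 : lam * ((r ^ lam - 1) / (lam * r)) = (r ^ lam - 1) / r := by field_simp
    rw [h3]
    beta_reduce
    generalize ((r ^ lam - 1) / r * v + 1) ^ (-1 / lam) = X
    have h4 : (r ^ lam - 1) / r * v + 1 ≠ 0 := by linarith
    generalize hB : (r ^ lam - 1) / r * v + 1 = B at h4
    field_simp

/-- The truncations for which the truncation point is the monopoly reserve. -/
lemma mem_truncationRange_iff (hlam : 0 ≤ lam) (hlam1 : lam ≤ 1) (hr : 1 ≤ r) :
    r ∈ truncationRange lam ↔ (1 - lam) * paretoRate lam r * r ≤ 1 := by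
  have hr0 : 0 < r := by linarith
  rcases hlam.eq_or_lt with rfl | hl
  · have h1 : (1 - 0) * paretoRate 0 r * r = Real.log r := by
      rw [paretoRate, if_pos rfl]
      field_simp
      ring
    rw [h1]
    constructor
    · rintro ⟨_, h, _⟩
      exact (Real.log_le_iff_le_exp hr0).2 (h rfl)
    · intro h
      exact ⟨hr, fun _ => (Real.log_le_iff_le_exp hr0).1 h, fun h0 => absurd h0 (lt_irrefl _)⟩
  have h1 : (1 - lam) * paretoRate lam r * r = (1 - lam) * (r ^ lam - 1) / lam := by
    rw [paretoRate, if_neg hl.ne']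
    field_simp
  rw [h1, div_le_one hl]
  rcases hlam1.eq_or_lt with rfl | hl1
  · constructor
    · intro _
      simp
    · intro _
      exact ⟨hr, fun h => absurd h one_ne_zero, fun _ h => absurd h (lt_irrefl _)⟩
  have hl' : 0 < 1 - lam := by linarith
  have h2 : (1 - lam) * (r ^ lam - 1) ≤ lam ↔ r ≤ (1 - lam) ^ (-1 / lam) := by
    have h3 : (1 - lam) ^ (-1 / lam) = ((1 - lam)⁻¹) ^ (lam⁻¹) := by
      rw [Real.inv_rpow hl'.le, ← Real.rpow_neg hl'.le]
      congr 1
      ring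
    rw [h3, Real.le_rpow_inv_iff_of_pos hr0.le (inv_nonneg.2 hl'.le) hl, le_inv_comm₀
      (Real.rpow_pos_of_pos hr0 _) hl', le_inv_comm₀ hl' (Real.rpow_pos_of_pos hr0 _),
      ← one_div, le_div_iff₀ hl']
    constructor <;> intro h <;> linarith
  rw [h2]
  exact ⟨fun h => h.2.2 hl hl1, fun h => ⟨hr, fun h0 => absurd h0 hl.ne', fun _ _ => h⟩⟩

/-- The form shows the sign: it is that of a linear factor non-increasing in `v`, so the sign at `r`
controls all of `[0, r]`. -/
lemma hasDerivAt_paretoRevenue (hlam : 0 ≤ lam) (hr : 1 ≤ r) {v : ℝ} (hv : 0 ≤ v) :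
    HasDerivAt (fun z => z * paretoSurvival lam r z)
      (paretoSurvival lam r v * (1 - (1 - lam) * paretoRate lam r * v) /
        (lam * paretoRate lam r * v + 1)) v := by
  refine ((hasDerivAt_id v).mul (hasDerivAt_paretoSurvival hlam hr hv)).congr_deriv ?_
  have hD := (paretoDenom_pos hlam hr hv).ne'
  have h := div_mul_cancel₀ (paretoRate lam r) hD
  simp only [id]
  rw [eq_div_iff hD]
  linear_combination (-(v * paretoSurvival lam r v)) * h

lemma strictMonoOn_paretoRevenue (hlam : 0 ≤ lam) (hlam1 : lam ≤ 1)
    (hr : r ∈ truncationRange lam) :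
    StrictMonoOn (fun z => z * paretoSurvival lam r z) (Icc 0 r) := by
  have hr1 : 1 ≤ r := hr.1
  have hrange := (mem_truncationRange_iff hlam hlam1 hr1).1 hr
  refine strictMonoOn_of_deriv_pos (convex_Icc 0 r) (fun z hz =>
    (hasDerivAt_paretoRevenue hlam hr1 hz.1).continuousAt.continuousWithinAt) fun z hz => ?_
  rw [interior_Icc] at hz
  rw [(hasDerivAt_paretoRevenue hlam hr1 hz.1.le).deriv]
  refine div_pos (mul_pos (paretoSurvival_pos hlam hr1 hz.1.le) ?_)
    (paretoDenom_pos hlam hr1 hz.1.le)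
  have hc : 0 ≤ (1 - lam) * paretoRate lam r :=
    mul_nonneg (by linarith) (paretoRate_nonneg hlam hr1)
  rcases hc.eq_or_lt with h | h
  · rw [← h]
    linarith
  · nlinarith [hz.2]

/-- The revenue at `r` equals `1`, so `r` is a maximizer on `[0, r]` and the left derivative there
is non-negative. -/
lemma mem_truncationRange_of_forall_le (hlam : 0 ≤ lam) (hlam1 : lam ≤ 1) (hr : 1 ≤ r)
    (h : ∀ z ∈ Icc 0 r, z * paretoSurvival lam r z ≤ 1) : r ∈ truncationRange lam := by
  have hr0 : 0 < r := by linarith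
  rw [mem_truncationRange_iff hlam hlam1 hr]
  have hd := hasDerivAt_paretoRevenue hlam hr hr0.le
  have hD := paretoDenom_pos hlam hr hr0.le
  have hS := paretoSurvival_pos hlam hr hr0.le
  have h1 := (hasDerivAt_iff_tendsto_slope.1 hd).mono_left
    (nhdsWithin_mono r (fun z (hz : z ∈ Iio r) => (ne_of_lt hz)))
  have h2 : 0 ≤ paretoSurvival lam r r * (1 - (1 - lam) * paretoRate lam r * r) /
        (lam * paretoRate lam r * r + 1) := by
    refine ge_of_tendsto h1 ?_
    filter_upwards [Ioo_mem_nhdsLT hr0] with z hz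
    have h3 := h z ⟨hz.1.le, hz.2.le⟩
    rw [slope_def_field, paretoSurvival_self hr, mul_inv_cancel₀ hr0.ne']
    exact div_nonneg_of_nonpos (by linarith) (by linarith [hz.2])
  rw [le_div_iff₀ hD, zero_mul] at h2
  have h3 := nonneg_of_mul_nonneg_right h2 hS
  linarith

lemma measurable_paretoSurvival : Measurable (paretoSurvival lam r) := by
  unfold paretoSurvival
  split_ifs <;> fun_prop

/-- The density of the truncated generalized Pareto distribution below its top. -/
noncomputable def paretoDensity (lam r : ℝ) : ℝ → ℝ :=
  (Ioo 0 r).indicator fun z =>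
    paretoSurvival lam r z * (paretoRate lam r / (lam * paretoRate lam r * z + 1))

lemma measurable_paretoDensity : Measurable (paretoDensity lam r) := by
  refine Measurable.indicator ?_ measurableSet_Ioo
  exact measurable_paretoSurvival.mul (by fun_prop)

variable (lam r) in
/-- The `r`-truncated `lam`-generalized Pareto distribution. -/
noncomputable def paretoMeasure : Measure ℝ :=
  volume.withDensity (fun v => ENNReal.ofReal (paretoDensity lam r v)) +
    ENNReal.ofReal r⁻¹ • Measure.dirac r

/-- The general set `s` covers half-lines ending before `r` and sets containing `(0, r]` alike. -/
lemma setLIntegral_paretoDensity (hlam : 0 ≤ lam) (hr : 1 ≤ r) {s : Set ℝ} {b : ℝ}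
    (hb : 0 ≤ b) (hsb : s ∩ Ioo 0 r = Ioo 0 b) :
    ∫⁻ v in s, ENNReal.ofReal (paretoDensity lam r v) =
      ENNReal.ofReal (1 - paretoSurvival lam r b) := by
  have h1 : (fun v => ENNReal.ofReal (paretoDensity lam r v)) = (Ioo 0 r).indicator fun z =>
      ENNReal.ofReal
        (paretoSurvival lam r z * (paretoRate lam r / (lam * paretoRate lam r * z + 1))) := by
    funext v
    unfold paretoDensity indicator
    split_ifs <;> simp
  rw [h1, setLIntegral_indicator measurableSet_Ioo, inter_comm, hsb,
    Measure.restrict_congr_set Ioo_ae_eq_Ico, lintegral_neg_deriv hb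
      (fun z hz => hasDerivAt_paretoSurvival hlam hr hz.1), paretoSurvival_zero]
  · refine ContinuousOn.mul (fun z hz => (hasDerivAt_paretoSurvival hlam hr
      hz.1).continuousAt.continuousWithinAt) (ContinuousOn.div (by fun_prop) (by fun_prop)
        fun z hz => (paretoDenom_pos hlam hr hz.1).ne')
  · exact fun z hz => mul_nonneg (paretoSurvival_pos hlam hr hz.1).le
      (div_nonneg (paretoRate_nonneg hlam hr) (paretoDenom_pos hlam hr hz.1).le)

lemma paretoMeasure_Iio_of_le (hlam : 0 ≤ lam) (hr : 1 ≤ r) {v : ℝ} (hv : 0 ≤ v) (hvr : v ≤ r) :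
    paretoMeasure lam r (Iio v) = ENNReal.ofReal (1 - paretoSurvival lam r v) := by
  rw [paretoMeasure, Measure.add_apply, Measure.smul_apply,
    withDensity_apply _ measurableSet_Iio,
    setLIntegral_paretoDensity hlam hr hv,
    Measure.dirac_apply' _ measurableSet_Iio]
  · simp [hvr]
  · ext z
    simp only [mem_inter_iff, mem_Iio, mem_Ioo]
    exact ⟨fun h => ⟨h.2.1, h.1⟩, fun h => ⟨h.2, h.1, h.2.trans_le hvr⟩⟩

lemma paretoMeasure_of_superset (hlam : 0 ≤ lam) (hr : 1 ≤ r) {s : Set ℝ} (hs : MeasurableSet s)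
    (hsub : Ioc 0 r ⊆ s) : paretoMeasure lam r s = 1 := by
  have hr0 : 0 < r := by linarith
  have hinv : r⁻¹ ≤ 1 := inv_le_one_of_one_le₀ hr
  rw [paretoMeasure, Measure.add_apply, Measure.smul_apply, withDensity_apply _ hs,
    setLIntegral_paretoDensity hlam hr hr0.le (inter_eq_right.2
      (Ioo_subset_Ioc_self.trans hsub)), Measure.dirac_apply' _ hs, paretoSurvival_self hr]
  have hrs : r ∈ s := hsub ⟨hr0, le_rfl⟩
  rw [indicator_of_mem hrs, Pi.one_apply, smul_eq_mul, mul_one,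
    ← ENNReal.ofReal_add (by linarith) (inv_nonneg.2 hr0.le)]
  simp

lemma isValuation_paretoMeasure (hlam : 0 ≤ lam) (hr : 1 ≤ r) :
    IsValuation (paretoMeasure lam r) where
  prob := ⟨paretoMeasure_of_superset hlam hr MeasurableSet.univ (subset_univ _)⟩
  nonneg := by
    rw [paretoMeasure_Iio_of_le hlam hr le_rfl (by linarith), paretoSurvival_zero]
    simp

lemma cdfLt_paretoMeasure (hlam : 0 ≤ lam) (hr : 1 ≤ r) {v : ℝ} (hv : 0 ≤ v) :
    cdfLt (paretoMeasure lam r) v = paretoCDF lam r v := by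
  rw [cdfLt, measureReal_def]
  rcases le_or_gt v r with h | h
  · rw [paretoCDF_of_le h, paretoMeasure_Iio_of_le hlam hr hv h, ENNReal.toReal_ofReal]
    linarith [paretoSurvival_le_one hlam hr hv]
  · rw [paretoCDF_of_lt h, paretoMeasure_of_superset hlam hr measurableSet_Iio]
    · simp
    · exact fun z hz => hz.2.trans_lt h

lemma paretoMeasure_mem_paretoClass (hlam : 0 ≤ lam) (hr : r ∈ truncationRange lam) :
    paretoMeasure lam r ∈ paretoClass lam :=
  ⟨isValuation_paretoMeasure hlam hr.1, r, hr, fun _ hv => cdfLt_paretoMeasure hlam hr.1 hv⟩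

lemma eq_of_cdfLt_eq {μ ν : Measure ℝ} (hμ : IsValuation μ) (hν : IsValuation ν)
    (h : ∀ v, 0 ≤ v → cdfLt μ v = cdfLt ν v) : μ = ν := by
  have := hμ.prob
  have := hν.prob
  refine Measure.ext_of_Ici μ ν fun a => (measureReal_eq_measureReal_iff).1 ?_
  rcases le_or_gt 0 a with ha | ha
  · rw [← one_sub_cdfLt, ← one_sub_cdfLt, h a ha]
  · rw [real_Ici_eq_one (measure_mono_null (Iio_subset_Iio ha.le) hμ.nonneg),
      real_Ici_eq_one (measure_mono_null (Iio_subset_Iio ha.le) hν.nonneg)]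

lemma exists_eq_paretoMeasure (hlam : 0 ≤ lam) {μ : Measure ℝ} (hμ : μ ∈ paretoClass lam) :
    ∃ r ∈ truncationRange lam, μ = paretoMeasure lam r := by
  obtain ⟨hval, r, hr, hcdf⟩ := hμ
  refine ⟨r, hr, eq_of_cdfLt_eq hval (isValuation_paretoMeasure hlam hr.1) fun v hv => ?_⟩
  rw [hcdf v hv, cdfLt_paretoMeasure hlam hr.1 hv]

lemma paretoMeasure_real_Ici_of_le (hlam : 0 ≤ lam) (hr : 1 ≤ r) {v : ℝ} (hv : 0 ≤ v)
    (hvr : v ≤ r) : (paretoMeasure lam r).real (Ici v) = paretoSurvival lam r v := by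
  have := (isValuation_paretoMeasure hlam hr).prob
  rw [← one_sub_cdfLt, cdfLt_paretoMeasure hlam hr hv, paretoCDF_of_le hvr]
  ring

lemma paretoMeasure_real_Ici_of_lt (hlam : 0 ≤ lam) (hr : 1 ≤ r) {v : ℝ} (hvr : r < v) :
    (paretoMeasure lam r).real (Ici v) = 0 := by
  have := (isValuation_paretoMeasure hlam hr).prob
  rw [← one_sub_cdfLt, cdfLt_paretoMeasure hlam hr (by linarith), paretoCDF_of_lt hvr]
  ring

/-- The truncation point is the unique monopoly reserve of a truncated Pareto distribution. -/
lemma isMonopolyReserve_paretoMeasure_iff (hlam : 0 ≤ lam) (hlam1 : lam ≤ 1)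
    (hr : r ∈ truncationRange lam) {s : ℝ} :
    IsMonopolyReserve (paretoMeasure lam r) s ↔ s = r := by
  have hr1 := hr.1
  have hr0 : 0 ≤ r := by linarith
  have := (isValuation_paretoMeasure hlam hr1).prob
  have hmono := strictMonoOn_paretoRevenue hlam hlam1 hr
  have hrr : r * (paretoMeasure lam r).real (Ici r) = 1 := by
    rw [paretoMeasure_real_Ici_of_le hlam hr1 hr0 le_rfl, paretoSurvival_self hr1]
    exact mul_inv_cancel₀ (by linarith)
  constructor
  · rintro ⟨hs, hmax⟩
    have h1 := hmax r hr0
    rw [one_sub_cdfLt, one_sub_cdfLt, hrr] at h1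
    rcases lt_trichotomy s r with h | h | h
    · have h2 := hmono ⟨hs, h.le⟩ (right_mem_Icc.2 hr0) h
      beta_reduce at h2
      rw [← paretoMeasure_real_Ici_of_le hlam hr1 hs h.le,
        ← paretoMeasure_real_Ici_of_le hlam hr1 hr0 le_rfl, hrr] at h2
      linarith
    · exact h
    · rw [paretoMeasure_real_Ici_of_lt hlam hr1 h] at h1
      linarith
  · rintro rfl
    refine ⟨hr0, fun p hp => ?_⟩
    rw [one_sub_cdfLt, one_sub_cdfLt]
    rcases le_or_gt p s with h | h
    · rw [paretoMeasure_real_Ici_of_le hlam hr1 hp h,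
        paretoMeasure_real_Ici_of_le hlam hr1 hr0 le_rfl]
      exact hmono.monotoneOn ⟨hp, h⟩ (right_mem_Icc.2 hr0) h
    · rw [paretoMeasure_real_Ici_of_lt hlam hr1 h, hrr]
      linarith

/-- Uniqueness of the monopoly reserve identifies the one chosen in `revOPT`. -/
lemma revOPT_paretoMeasure (hlam : 0 ≤ lam) (hlam1 : lam ≤ 1) (hr : r ∈ truncationRange lam)
    (m n : ℕ) : revOPT m n (paretoMeasure lam r) =
      expectedRevenue (N := n) (reservePayment m r) (paretoMeasure lam r) := by
  have hex : ∃ s, IsMonopolyReserve (paretoMeasure lam r) s :=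
    ⟨r, (isMonopolyReserve_paretoMeasure_iff hlam hlam1 hr).2 rfl⟩
  rw [revOPT, dif_pos hex,
    (isMonopolyReserve_paretoMeasure_iff hlam hlam1 hr).1 hex.choose_spec]

lemma belowTop_paretoMeasure (hlam : 0 ≤ lam) (hr : 1 ≤ r) :
    belowTop (paretoMeasure lam r) = Iio r := by
  have hval := isValuation_paretoMeasure hlam hr
  have := hval.prob
  ext v
  simp only [belowTop, mem_ofPred_eq, mem_Iio]
  constructor
  · intro h
    by_contra hv
    push Not at hv
    have h1 : paretoMeasure lam r (Iic r) = 1 :=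
      paretoMeasure_of_superset hlam hr measurableSet_Iic fun z hz => hz.2
    have h2 : paretoMeasure lam r (Ioi r) = 0 := by
      rw [← compl_Iic, prob_compl_eq_zero_iff measurableSet_Iic, h1]
    exact h.ne' (measure_mono_null (Ioi_subset_Ioi hv) h2)
  · intro h
    have h1 : 0 < (paretoMeasure lam r).real (Ici r) := by
      rw [paretoMeasure_real_Ici_of_le hlam hr (by linarith) le_rfl]
      exact paretoSurvival_pos hlam hr (by linarith)
    rw [measureReal_def] at h1
    exact (ENNReal.toReal_pos_iff.1 h1).1.trans_le (measure_mono (Ici_subset_Ioi.2 h))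

/-- For `r = 1` the distribution is a point mass with nothing strictly inside its support; excluding
it makes the hazard rate positive. -/
lemma insideSupport_paretoMeasure_subset (hlam : 0 ≤ lam) (hr : 1 ≤ r) {v : ℝ}
    (hv : v ∈ insideSupport (paretoMeasure lam r)) : v ∈ Ioo 0 r ∧ 1 < r := by
  have hval := isValuation_paretoMeasure hlam hr
  have hvr : v < r := by
    have h : v ∈ belowTop (paretoMeasure lam r) := hv.2
    rwa [belowTop_paretoMeasure hlam hr] at h
  have hv0 : 0 < v := by
    by_contra h
    push Not at h
    exact hv.1.ne' (measure_mono_null (Iio_subset_Iio h) hval.nonneg)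
  refine ⟨⟨hv0, hvr⟩, hr.lt_of_ne ?_⟩
  rintro rfl
  have h1 := hv.1
  rw [paretoMeasure_Iio_of_le hlam hr hv0.le hvr.le, paretoSurvival] at h1
  simp at h1

theorem paretoClass_subset_regularClass (hlam : 0 ≤ lam) :
    paretoClass lam ⊆ regularClass lam := by
  intro μ hμ
  obtain ⟨r, hr, rfl⟩ := exists_eq_paretoMeasure hlam hμ
  have hr1 := hr.1
  have hval := isValuation_paretoMeasure hlam hr1
  have := hval.prob
  refine ⟨hval, paretoDensity lam r, ⟨measurable_paretoDensity, ?_⟩, ?_, ?_⟩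
  · rw [belowTop_paretoMeasure hlam hr1, paretoMeasure, Measure.restrict_add,
      restrict_withDensity measurableSet_Iio, Measure.restrict_smul, restrict_dirac']
    · simp
    · exact measurableSet_Iio
  · intro v hv
    obtain ⟨hv', hr1'⟩ := insideSupport_paretoMeasure_subset hlam hr1 hv
    rw [paretoDensity, indicator_of_mem hv']
    exact mul_pos (paretoSurvival_pos hlam hr1 hv'.1.le)
      (div_pos (paretoRate_pos hlam hr1') (paretoDenom_pos hlam hr1 hv'.1.le))
  · have hconst : ∀ v ∈ insideSupport (paretoMeasure lam r),
        virtualValue lam (paretoMeasure lam r) (paretoDensity lam r) v =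
          -1 / paretoRate lam r := by
      intro v hv
      obtain ⟨hv', hr1'⟩ := insideSupport_paretoMeasure_subset hlam hr1 hv
      have hS := (paretoSurvival_pos hlam hr1 hv'.1.le).ne'
      have hD := (paretoDenom_pos hlam hr1 hv'.1.le).ne'
      have hg := (paretoRate_pos hlam hr1').ne'
      rw [virtualValue, one_sub_cdfLt, paretoMeasure_real_Ici_of_le hlam hr1 hv'.1.le hv'.2.le,
        paretoDensity, indicator_of_mem hv']
      field_simp
      ring
    intro x hx y hy _
    rw [hconst x hx, hconst y hy]

end

/-! ### The uniform distribution is regular but not a truncated Pareto distribution -/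

lemma uniform_Iio {v : ℝ} (h1 : v ≤ 1) :
    (volume.restrict (Icc (0 : ℝ) 1)) (Iio v) = ENNReal.ofReal v := by
  rw [Measure.restrict_apply measurableSet_Iio]
  have : Iio v ∩ Icc 0 1 = Ico 0 v := by
    ext t
    simp only [mem_inter_iff, mem_Iio, mem_Icc, mem_Ico]
    exact ⟨fun h => ⟨h.2.1, h.1⟩, fun h => ⟨h.2, h.1, h.2.le.trans h1⟩⟩
  rw [this, Real.volume_Ico, sub_zero]

lemma belowTop_uniform : belowTop (volume.restrict (Icc (0 : ℝ) 1)) = Iio 1 := by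
  ext v
  simp only [belowTop, mem_ofPred_eq, mem_Iio, Measure.restrict_apply measurableSet_Ioi]
  constructor
  · intro h
    by_contra hv
    push Not at hv
    refine h.ne' ?_
    have : Ioi v ∩ Icc 0 1 = ∅ := by
      ext t
      simp only [mem_inter_iff, mem_Ioi, mem_Icc, mem_empty_iff_false, iff_false]
      rintro ⟨h1, _, h2⟩
      linarith
    rw [this, measure_empty]
  · intro h
    have hsub : Ioc (max v 0) 1 ⊆ Ioi v ∩ Icc 0 1 := fun t ht =>
      ⟨(le_max_left _ _).trans_lt ht.1, ((le_max_right _ _).trans_lt ht.1).le, ht.2⟩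
    refine lt_of_lt_of_le ?_ (measure_mono hsub)
    rw [Real.volume_Ioc, ENNReal.ofReal_pos, sub_pos]
    exact max_lt h one_pos

lemma isValuation_uniform : IsValuation (volume.restrict (Icc (0 : ℝ) 1)) where
  prob := inferInstance
  nonneg := by
    rw [uniform_Iio zero_le_one, ENNReal.ofReal_zero]

lemma uniform_mem_regularClass {lam : ℝ} (hlam : 0 ≤ lam) :
    volume.restrict (Icc (0 : ℝ) 1) ∈ regularClass lam := by
  have hin : ∀ v ∈ insideSupport (volume.restrict (Icc (0 : ℝ) 1)), v ∈ Ioo 0 1 := by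
    intro v hv
    refine ⟨?_, ?_⟩
    · by_contra h
      push Not at h
      exact hv.1.ne' (measure_mono_null (Iio_subset_Iio h) isValuation_uniform.nonneg)
    · have h : v ∈ belowTop (volume.restrict (Icc (0 : ℝ) 1)) := hv.2
      rwa [belowTop_uniform] at h
  refine ⟨isValuation_uniform, (Icc 0 1).indicator 1, ⟨?_, ?_⟩, ?_, ?_⟩
  · exact measurable_one.indicator measurableSet_Icc
  · have h1 : (fun v => ENNReal.ofReal ((Icc (0 : ℝ) 1).indicator 1 v)) =
        (Icc (0 : ℝ) 1).indicator 1 := by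
      funext v
      unfold indicator
      split_ifs <;> simp
    rw [h1, withDensity_indicator_one measurableSet_Icc, belowTop_uniform,
      Measure.restrict_comm measurableSet_Iio]
  · intro v hv
    rw [indicator_of_mem (Ioo_subset_Icc_self (hin v hv))]
    exact one_pos
  · have hvv : ∀ v ∈ insideSupport (volume.restrict (Icc (0 : ℝ) 1)),
        virtualValue lam (volume.restrict (Icc (0 : ℝ) 1)) ((Icc 0 1).indicator 1) v =
          (lam + 1) * v - 1 := by
      intro v hv
      have hv' := hin v hv
      rw [virtualValue, cdfLt, measureReal_def, uniform_Iio hv'.2.le,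
        ENNReal.toReal_ofReal hv'.1.le, indicator_of_mem (Ioo_subset_Icc_self hv'), Pi.one_apply]
      ring
    intro x hx y hy hxy
    rw [hvv x hx, hvv y hy]
    have := mul_le_mul_of_nonneg_left hxy (by linarith : 0 ≤ lam + 1)
    linarith

/-- At price `1 ≤ r` a truncated Pareto distribution still sells with positive probability, the
uniform one does not. -/
lemma uniform_notMem_paretoClass {lam : ℝ} (hlam : 0 ≤ lam) :
    volume.restrict (Icc (0 : ℝ) 1) ∉ paretoClass lam := by
  rintro ⟨_, r, hr, h⟩
  have h1 := h 1 zero_le_one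
  rw [cdfLt, measureReal_def, uniform_Iio le_rfl, paretoCDF_of_le hr.1] at h1
  have := paretoSurvival_pos hlam hr.1 zero_le_one
  simp only [ENNReal.ofReal_one, ENNReal.toReal_one] at h1
  linarith

theorem paretoClass_ssubset_regularClass {lam : ℝ} (hlam : 0 ≤ lam) :
    paretoClass lam ⊂ regularClass lam :=
  (ssubset_iff_of_subset (paretoClass_subset_regularClass hlam)).2
    ⟨_, uniform_mem_regularClass hlam, uniform_notMem_paretoClass hlam⟩

/-! ### Reduction to truncated generalized Pareto distributions -/

/-- The scaling `r / p` carries `p` to `r` and multiplies the hazard rate at `0` by `r / p`. For `r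
= 1` that rate vanishes, but then `μ` sells surely up to `p`. -/
lemma survival_rescaled_le {lam : ℝ} (hlam : 0 ≤ lam) {μ : Measure ℝ}
    (hμ : μ ∈ regularClass lam) {p r : ℝ} (hp0 : 0 < p) (hr : r⁻¹ = μ.real (Ici p)) (hr1 : 1 ≤ r)
    {v : ℝ} (hv : v ∈ Icc 0 p) : paretoSurvival lam r (r / p * v) ≤ μ.real (Ici v) := by
  obtain ⟨hval, f, hf, hf0, hmono⟩ := hμ
  have := hval.prob
  have hr0 : 0 < r := by linarith
  have hc : 0 < r / p := div_pos hr0 hp0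
  rcases hr1.eq_or_lt with rfl | hr1'
  · refine (paretoSurvival_le_one hlam le_rfl (mul_nonneg hc.le hv.1)).trans ?_
    rw [← inv_one, hr]
    exact real_Ici_anti μ hv.2
  · refine pareto_le_survival (T := fun v => paretoSurvival lam r (r / p * v)) hlam hval hf hf0
      hmono (mul_pos (paretoRate_pos hlam hr1') hc) (p := p) ?_ ?_ ?_ ?_ ?_ hv
    · rw [← hr]
      exact inv_pos.2 hr0
    · intro z hz
      have h1 := hasDerivAt_paretoSurvival hlam hr1 (mul_nonneg hc.le hz.1)
      have h2 : HasDerivAt (fun z => r / p * z) (r / p * 1) z := (hasDerivAt_id z).const_mul _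
      refine (h1.comp z h2).congr_deriv ?_
      have h3 : lam * (paretoRate lam r * (r / p)) * z = lam * paretoRate lam r * (r / p * z) := by
        ring
      rw [h3]
      ring
    · exact fun z hz => paretoSurvival_pos hlam hr1 (mul_nonneg hc.le hz.1)
    · exact fun z hz => paretoSurvival_le_one hlam hr1 (mul_nonneg hc.le hz.1)
    · rw [div_mul_cancel₀ _ hp0.ne', paretoSurvival_self hr1, hr]

lemma excess_zero (m : ℕ) : excess m 0 = 0 := by simp [excess]

lemma lintegral_comp_mul_left_pos {c : ℝ} (hc : 0 < c) (G : ℝ → ℝ≥0∞) :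
    ENNReal.ofReal c * ∫⁻ y, G (c * y) = ∫⁻ x, G x := by
  conv_rhs => rw [← Real.smul_map_volume_mul_left hc.ne', abs_of_pos hc]
  rw [lintegral_smul_measure, smul_eq_mul]
  congr 1
  exact ((Homeomorph.mulLeft₀ c hc.ne').measurableEmbedding.lintegral_map G).symm

/-- If the price `p` is optimal among the prices up to `p`, then a guarantee for truncated Pareto
distributions carries over to the mechanism with reserve `p`. -/
theorem reserveRevenue_le_revVCG {lam : ℝ} (hlam : 0 ≤ lam) (hlam1 : lam ≤ 1) {m n N : ℕ}
    (hnN : n ≤ N) {Γ : ℝ≥0∞} (hΓ : Γ ≤ 1)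
    (hpar : ∀ ν ∈ paretoClass lam, Γ * revOPT m n ν ≤ revVCG m N ν) {μ : Measure ℝ}
    (hμ : μ ∈ regularClass lam) {p : ℝ} (hp : 0 < p) (hS : 0 < μ.real (Ici p))
    (hmax : ∀ z ∈ Icc 0 p, z * μ.real (Ici z) ≤ p * μ.real (Ici p)) :
    Γ * expectedRevenue (N := n) (reservePayment m p) μ ≤ revVCG m N μ := by
  have hval := hμ.1
  have := hval.prob
  obtain ⟨r, hr⟩ : ∃ r : ℝ, r⁻¹ = μ.real (Ici p) := ⟨(μ.real (Ici p))⁻¹, inv_inv _⟩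
  have hr0 : 0 < r := by rwa [← hr, inv_pos] at hS
  have hr1 : 1 ≤ r := by
    have h1 : r⁻¹ ≤ 1 := hr ▸ measureReal_le_one
    exact (inv_le_one₀ hr0).1 h1
  have hdom : ∀ z ∈ Icc 0 r, paretoSurvival lam r z ≤ μ.real (Ici (p / r * z)) := by
    intro z hz
    have hv : p / r * z ∈ Icc 0 p := by
      refine ⟨mul_nonneg (div_pos hp hr0).le hz.1, ?_⟩
      calc p / r * z ≤ p / r * r := mul_le_mul_of_nonneg_left hz.2 (div_pos hp hr0).le
        _ = p := div_mul_cancel₀ _ hr0.ne'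
    have h1 := survival_rescaled_le hlam hμ hp hr hr1 hv
    have h2 : r / p * (p / r * z) = z := by field_simp
    rwa [h2] at h1
  -- Domination transfers the optimality of `p` among lower prices to the Pareto revenue curve.
  have hrange : r ∈ truncationRange lam := by
    refine mem_truncationRange_of_forall_le hlam hlam1 hr1 fun z hz => ?_
    have hc := div_pos hp hr0
    have hv : p / r * z ∈ Icc 0 p := by
      refine ⟨mul_nonneg hc.le hz.1, ?_⟩
      calc p / r * z ≤ p / r * r := mul_le_mul_of_nonneg_left hz.2 hc.le
        _ = p := div_mul_cancel₀ _ hr0.ne'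
    have h1 := hmax _ hv
    have h2 := mul_le_mul_of_nonneg_left (hdom z hz) hv.1
    rw [← hr] at h1
    have h3 : p / r * z * paretoSurvival lam r z ≤ p / r * 1 := by
      refine (h2.trans h1).trans (le_of_eq ?_)
      rw [mul_one, div_eq_mul_inv]
    rw [mul_assoc] at h3
    exact le_of_mul_le_mul_left h3 hc
  set ν := paretoMeasure lam r with hν
  have hνval : IsValuation ν := isValuation_paretoMeasure hlam hr1
  have := hνval.prob
  have hguar := hpar ν (paretoMeasure_mem_paretoClass hlam hrange)
  rw [revOPT_paretoMeasure hlam hlam1 hrange, expectedRevenue_reservePayment m hr0.le,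
    revVCG_eq m N hνval] at hguar
  have hsale : demandMean n (fun k => ((min m k : ℕ) : ℝ≥0∞)) ν r =
      demandMean n (fun k => ((min m k : ℕ) : ℝ≥0∞)) μ p := by
    apply demandMean_congr
    rw [paretoMeasure_real_Ici_of_le hlam hr1 hr0.le le_rfl, paretoSurvival_self hr1, hr]
  have hlow : ENNReal.ofReal (p / r) * ∫⁻ y in Ioi 0, demandMean N (excess m) ν y ≤
      ∫⁻ x in Ioc 0 p, demandMean N (excess m) μ x := by
    have hc := div_pos hp hr0
    rw [← lintegral_indicator measurableSet_Ioc, ← lintegral_comp_mul_left_pos hc]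
    refine mul_le_mul_right ?_ _
    rw [← lintegral_indicator measurableSet_Ioi]
    refine lintegral_mono fun y => ?_
    by_cases hy : y ∈ Ioi (0 : ℝ)
    swap
    · rw [indicator_of_notMem hy]
      exact zero_le
    rw [indicator_of_mem hy]
    rcases le_or_gt y r with hyr | hyr
    · have hv : p / r * y ∈ Ioc 0 p := by
        refine ⟨mul_pos hc hy, ?_⟩
        calc p / r * y ≤ p / r * r := mul_le_mul_of_nonneg_left hyr hc.le
          _ = p := div_mul_cancel₀ _ hr0.ne'
      rw [indicator_of_mem hv]
      refine demandMean_mono N (excess_mono m) ?_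
      rw [paretoMeasure_real_Ici_of_le hlam hr1 (le_of_lt hy) hyr]
      exact hdom y ⟨le_of_lt hy, hyr⟩
    · rw [demandMean_eq_of_null N _ (paretoMeasure_real_Ici_of_lt hlam hr1 hyr), excess_zero]
      exact zero_le
  have hprice : ENNReal.ofReal p = ENNReal.ofReal (p / r) * ENNReal.ofReal r := by
    rw [← ENNReal.ofReal_mul (div_pos hp hr0).le, div_mul_cancel₀ _ hr0.ne']
  have hsplit : ∫⁻ x in Ioi 0, demandMean N (excess m) μ x =
      (∫⁻ x in Ioc 0 p, demandMean N (excess m) μ x) +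
        ∫⁻ x in Ioi p, demandMean N (excess m) μ x := by
    rw [← lintegral_union measurableSet_Ioi, Ioc_union_Ioi_eq_Ioi hp.le]
    rw [Set.disjoint_left]
    exact fun z hz hz' => absurd hz.2 (not_le.2 hz')
  rw [expectedRevenue_reservePayment m hp.le, revVCG_eq m N hval, hsplit, mul_add, mul_add]
  -- Posted-price revenue at `p` against competition below `p`, through the Pareto guarantee; then
  -- competition above `p` against itself with more buyers.
  refine add_le_add ?_ ?_
  · calc Γ * (ENNReal.ofReal p * demandMean n (fun k => ((min m k : ℕ) : ℝ≥0∞)) μ p)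
        = ENNReal.ofReal (p / r) *
            (Γ * (ENNReal.ofReal r * demandMean n (fun k => ((min m k : ℕ) : ℝ≥0∞)) ν r)) := by
          rw [hprice, hsale]
          ring
      _ ≤ ENNReal.ofReal (p / r) * (m * ∫⁻ y in Ioi 0, demandMean N (excess m) ν y) := by
          refine mul_le_mul_right (le_trans (mul_le_mul_right ?_ _) hguar) _
          exact le_self_add
      _ = m * (ENNReal.ofReal (p / r) * ∫⁻ y in Ioi 0, demandMean N (excess m) ν y) := by ring
      _ ≤ m * ∫⁻ x in Ioc 0 p, demandMean N (excess m) μ x := by gcongr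
  · calc Γ * (m * ∫⁻ x in Ioi p, demandMean n (excess m) μ x)
        ≤ 1 * (m * ∫⁻ x in Ioi p, demandMean n (excess m) μ x) := by gcongr
      _ ≤ m * ∫⁻ x in Ioi p, demandMean N (excess m) μ x := by
          rw [one_mul]
          gcongr with x
          exact demandMean_mono_right hnN (excess_mono m) μ x

/-- Zero optimal revenue means that no positive price ever sells. This case is separate because the
rescaling needs `p` and its sale probability to be positive. -/
lemma expectedRevenue_eq_zero_of_degenerate {m n : ℕ} {μ : Measure ℝ} [IsProbabilityMeasure μ]
    {p : ℝ} (hp : 0 ≤ p) (hmax : ∀ z, 0 ≤ z → z * μ.real (Ici z) ≤ p * μ.real (Ici p))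
    (h0 : p * μ.real (Ici p) = 0) :
    expectedRevenue (N := n) (reservePayment m p) μ = 0 := by
  rw [expectedRevenue_reservePayment m hp]
  have h1 : ENNReal.ofReal p * demandMean n (fun k => ((min m k : ℕ) : ℝ≥0∞)) μ p = 0 := by
    rcases mul_eq_zero.1 h0 with h | h
    · rw [h, ENNReal.ofReal_zero, zero_mul]
    · rw [demandMean_eq_of_null n _ h]
      simp
  have h2 : ∫⁻ x in Ioi p, demandMean n (excess m) μ x = 0 := by
    rw [setLIntegral_congr_fun measurableSet_Ioi (g := fun _ => 0), lintegral_zero]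
    intro x hx
    have hx0 : 0 < x := hp.trans_lt hx
    have h3 := hmax x hx0.le
    rw [h0] at h3
    have h4 : μ.real (Ici x) = 0 :=
      le_antisymm (by by_contra h; push Not at h; nlinarith) measureReal_nonneg
    simp only
    rw [demandMean_eq_of_null n _ h4, excess_zero]
  rw [h1, h2, mul_zero, add_zero]

/-- A guarantee for truncated Pareto distributions carries over to all regular distributions. -/
theorem guarantee_of_pareto {lam : ℝ} (hlam : 0 ≤ lam) (hlam1 : lam ≤ 1) {m n N : ℕ}
    (hnN : n ≤ N) {Γ : ℝ≥0∞} (hΓ0 : Γ ≠ 0) (hΓ : Γ ≤ 1)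
    (hpar : ∀ ν ∈ paretoClass lam, Γ * revOPT m n ν ≤ revVCG m N ν) {μ : Measure ℝ}
    (hμ : μ ∈ regularClass lam) : Γ * revOPT m n μ ≤ revVCG m N μ := by
  have := hμ.1.prob
  by_cases hex : ∃ r, IsMonopolyReserve μ r
  · rw [revOPT, dif_pos hex]
    obtain ⟨hp, hmax⟩ := hex.choose_spec
    -- Any monopoly reserve will do, so the choice made in `revOPT` is irrelevant.
    generalize hex.choose = p at hp hmax
    simp only [one_sub_cdfLt] at hmax
    have h0 : 0 ≤ p * μ.real (Ici p) := mul_nonneg hp measureReal_nonneg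
    rcases h0.eq_or_lt with h | h
    · rw [expectedRevenue_eq_zero_of_degenerate hp hmax h.symm, mul_zero]
      exact zero_le
    · exact reserveRevenue_le_revVCG hlam hlam1 hnN hΓ hpar hμ (pos_of_mul_pos_left h
        measureReal_nonneg) (pos_of_mul_pos_right h hp) fun z hz => hmax z hz.1
  · rw [revOPT, dif_neg hex]
    have hmono := fun x y : ℝ => postedRevenue_mono_of_not_exists hlam1 hμ hex (x := x) (y := y)
    have hbound : ∀ p : ℝ, 0 < p →
        Γ * expectedRevenue (N := n) (reservePayment m p) μ ≤ revVCG m N μ := by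
      intro p hp
      refine reserveRevenue_le_revVCG hlam hlam1 hnN hΓ hpar hμ hp ?_
        fun z hz => hmono z p hz.1 hz.2
      -- If nothing sold at `p`, the revenue would be non-decreasing up to `p` and zero afterwards,
      -- making `p` a monopoly reserve.
      refine lt_of_le_of_ne measureReal_nonneg fun h => hex ⟨p, hp.le, fun z hz => ?_⟩
      rw [one_sub_cdfLt, one_sub_cdfLt]
      rcases le_total z p with hzp | hzp
      · exact hmono z p hz hzp
      · exact mul_le_mul_of_nonneg_left (real_Ici_anti μ hzp) hz |>.trans (by rw [← h]; simp)
    have hlim : Filter.limsup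
        (fun p : ℝ => expectedRevenue (N := n) (reservePayment m p) μ) Filter.atTop ≤
          revVCG m N μ / Γ := by
      refine Filter.limsup_le_of_le (by isBoundedDefault) ?_
      filter_upwards [Filter.eventually_gt_atTop 0] with p hp
      rw [ENNReal.le_div_iff_mul_le (Or.inl hΓ0) (Or.inl (hΓ.trans_lt ENNReal.one_lt_top).ne),
        mul_comm]
      exact hbound p hp
    exact ENNReal.mul_le_of_le_div' hlim

end VCGCompetition

theorem proposition4p1 (lam : ℝ) (hlam : lam ∈ Set.Icc (0 : ℝ) 1) (m n : ℕ) (hmn : m ≤ n)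
    (Γ : ℝ) (hΓ : Γ ∈ Set.Ioc (0 : ℝ) 1) :
    VCGCompetition.paretoClass lam ⊂ VCGCompetition.regularClass lam ∧
      VCGCompetition.competitionComplexity m n (VCGCompetition.regularClass lam) Γ =
        VCGCompetition.competitionComplexity m n (VCGCompetition.paretoClass lam) Γ := by
  refine ⟨VCGCompetition.paretoClass_ssubset_regularClass hlam.1, ?_⟩
  unfold VCGCompetition.competitionComplexity
  refine iInf_congr fun k => iInf_congr_Prop ⟨fun h μ hμ => ?_, fun h μ hμ => ?_⟩ fun _ => rfl
  · exact h μ (VCGCompetition.paretoClass_subset_regularClass hlam.1 hμ)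
  · exact VCGCompetition.guarantee_of_pareto hlam.1 hlam.2 (Nat.le_add_right n k)
      (ENNReal.ofReal_pos.2 hΓ.1).ne' (ENNReal.ofReal_le_one.2 hΓ.2) h hμ
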